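/- Let $\Lambda$ be a finitely generated group with a finite generating set $S$, and let $r=|S|$. For $\gamma\in\Lambda$ let $|\gamma|$ be its word length with respect to $S$ (the least length of a word in elements of $S$ and their inverses that represents $\gamma$). Let $\lambda$ be the left regular representation of $\Lambda$ on $\ell^2(\Lambda)$, extended linearly to $\mathbb{C}[\Lambda]$, and let $\tau(a)=\langle\delta_e,a\,\delta_e\rangle$ be the canonical trace. For $x=\sum_\gamma\alpha_\gamma\gamma\in\mathbb{C}[\Lambda]$ put $x^*=\sum_\gamma\bar\alpha_\gamma\gamma^{-1}$, let $|x|$ be the maximal word length of an element of the support of $x$ (with $|0|=0$), and let $\|x\|_{C^*(\Lambda)}=\sup_\pi\|\pi(x)\|$, where the supremum is over all unitary representations $\pi$ of $\Lambda$. For each $n\ge 1$ let $\pi_n:\Lambda\to\mathrm{U}(n)$ be a random unitary representation, extended linearly to $\mathbb{C}[\Lambda]$, and let $\operatorname{ntr}M=\frac1n\operatorname{tr}M$ for an $n\times n$ matrix $M$. All norms of operators and matrices are operator norms. Suppose that the following two assumptions hold. 1. There are a constant $C\ge1$ and constants $u_k(\gamma)\in\mathbb{R}$ for $k\in\{0,1,2,\dots\}$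 and $\gamma\in\Lambda$, such that $u_0(\gamma)=\tau(\lambda(\gamma))$ and $$\Bigg|\mathbf{E}\big[\operatorname{ntr}\pi_n(\gamma)\big]-\sum_{k=0}^{q-1}\frac{u_k(\gamma)}{n^k}\Bigg|\le\frac{(Cq)^{Cq}}{n^q}$$ for all $\gamma\in\Lambda$, all integers $q\ge|\gamma|$, and all integers $n\ge1$ with $n\ge Cq^C$ (with the convention $0^0=1$). 2. With $u_1$ extended linearly to $\mathbb{C}[\Lambda]$, every self-adjoint $x\in\mathbb{C}[\Lambda]$ satisfies $$\limsup_{p\to\infty}|u_1(x^p)|^{1/p}\le\|\lambda(x)\|.$$ Then for every self-adjoint $x\in\mathbb{C}[\Lambda]$, with $K=\|x\|_{C^*(\Lambda)}$, every integer $n\ge1$ and every $\varepsilon>0$, $$\mathbf{P}\big[\|\pi_n(x)\|\ge\|\lambda(x)\|+\varepsilon\big]\le\frac{r^2}{n}\left(\frac{c\,|x|\,K}{\varepsilon}\right)^{c}.$$ Here $c>0$ is a constant that depends only on $C$. -/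

import Mathlib

open scoped ENNReal

noncomputable section

namespace GroupStrongConv

universe u v

/-! ### Group algebra and word length -/

/-- `x = ∑ αᵧ γ` is self-adjoint for the involution `(∑ αᵧ γ)^* = ∑ conj(αᵧ) γ⁻¹`. -/
def IsSelfAdj {Λ : Type u} [Group Λ] (x : MonoidAlgebra ℂ Λ) : Prop :=
  ∀ γ : Λ, x.coeff γ⁻¹ = star (x.coeff γ)

/-- Word length of `γ` with respect to `S`: the least length of a word in the letters
`s, s⁻¹` (`s ∈ S`) that represents `γ`. -/
def wordLength {Λ : Type u} [Group Λ] (S : Finset Λ) (γ : Λ) : ℕ :=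
  sInf {m : ℕ | ∃ l : List Λ, (∀ s ∈ l, s ∈ S ∨ s⁻¹ ∈ S) ∧ l.prod = γ ∧ l.length = m}

/-- `|x|`: the maximal word length of a group element in the support of `x`. -/
def wordDegree {Λ : Type u} [Group Λ] (S : Finset Λ) (x : MonoidAlgebra ℂ Λ) : ℕ :=
  x.coeff.support.sup (wordLength S)

/-- Linear extension of `f : Λ → ℝ` to the complex group algebra. -/
def linExt {Λ : Type u} (f : Λ → ℝ) (x : MonoidAlgebra ℂ Λ) : ℂ :=
  x.coeff.sum fun γ a => a * (f γ : ℂ)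

/-! ### Unitary representations -/

/-- Linear extension to the group algebra of a homomorphism from `Λ` to the unitaries of a
complex star algebra `A` (used for `A` the bounded operators on a Hilbert space and for
`A = M_n(ℂ)`). -/
def repExt {Λ : Type u} [Group Λ] {A : Type v} [Ring A] [StarRing A] [Algebra ℂ A]
    (π : Λ →* unitary A) : MonoidAlgebra ℂ Λ →ₐ[ℂ] A :=
  MonoidAlgebra.lift ℂ A Λ ((unitary A).subtype.comp π)

/-- The operator norm of a matrix acting on the Euclidean space `ℂⁿ`. -/
def matOpNorm {n : ℕ} (M : Matrix (Fin n) (Fin n) ℂ) : ℝ :=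
  ‖Matrix.toEuclideanCLM (n := Fin n) (𝕜 := ℂ) M‖

/-- The normalized trace of an `n × n` matrix (of interest for `n ≥ 1`). -/
def ntr {n : ℕ} (M : Matrix (Fin n) (Fin n) ℂ) : ℂ :=
  (n : ℂ)⁻¹ * M.trace

/-- The norms `‖π(x)‖` over all unitary representations `π` of `Λ`. Since every cyclic
representation of `Λ : Type u` is unitarily equivalent to one on a Hilbert space in `Type u`,
and since a norm `‖π(x)‖` is the supremum over the cyclic subrepresentations of `π`,
it suffices to let the Hilbert spaces range over `Type u`. -/
def repNorms {Λ : Type u} [Group Λ] (x : MonoidAlgebra ℂ Λ) : Set ℝ :=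
  {c : ℝ | ∃ (H : Type u) (_ : NormedAddCommGroup H) (_ : InnerProductSpace ℂ H)
    (_ : CompleteSpace H) (π : Λ →* unitary (H →L[ℂ] H)), c = ‖repExt π x‖}

/-- The norm of `x` in the full (maximal) group C*-algebra: `sup_π ‖π(x)‖`. -/
def fullNorm {Λ : Type u} [Group Λ] (x : MonoidAlgebra ℂ Λ) : ℝ :=
  sSup (repNorms x)

/-- The supremum in `fullNorm` is over a bounded set. -/
theorem bddAbove_repNorms {Λ : Type u} [Group Λ] (x : MonoidAlgebra ℂ Λ) :
    BddAbove (repNorms x) := by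
  refine ⟨∑ γ ∈ x.coeff.support, ‖x.coeff γ‖, ?_⟩
  rintro _ ⟨H, _, _, _, π, rfl⟩
  rw [repExt, MonoidAlgebra.lift_apply, Finsupp.sum]
  refine (norm_sum_le _ _).trans (Finset.sum_le_sum fun γ _ => ?_)
  rw [norm_smul]
  refine mul_le_of_le_one_right (norm_nonneg _) ?_
  refine ContinuousLinearMap.opNorm_le_bound _ zero_le_one fun v => ?_
  rw [one_mul]
  exact ((Unitary.linearIsometryEquiv (𝕜 := ℂ) (π γ)).norm_map v).le

/-- The supremum in `fullNorm` is over a nonempty set. -/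
theorem nonempty_repNorms {Λ : Type u} [Group Λ] (x : MonoidAlgebra ℂ Λ) :
    (repNorms x).Nonempty :=
  ⟨_, EuclideanSpace ℂ PEmpty.{u + 1}, inferInstance, inferInstance, inferInstance, 1, rfl⟩

/-! ### The left regular representation and the canonical trace -/

/-- The Hilbert space `ℓ²(Λ)`. -/
abbrev ellTwo (Λ : Type u) : Type u := lp (fun _ : Λ => ℂ) 2

/-- Precomposition of `f ∈ ℓ²(Λ)` with a permutation of `Λ`. -/
def ellTwoComp {Λ : Type u} (e : Λ ≃ Λ) (f : ellTwo Λ) : ellTwo Λ :=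
  ⟨fun x => f (e x), by
    refine memℓp_gen ?_
    have h := (memℓp_gen_iff (p := 2) (by norm_num)).1 (lp.memℓp f)
    exact (e.summable_iff (f := fun x => ‖f x‖ ^ (2 : ℝ≥0∞).toReal)).2 h⟩

theorem norm_ellTwoComp {Λ : Type u} (e : Λ ≃ Λ) (f : ellTwo Λ) :
    ‖ellTwoComp e f‖ = ‖f‖ := by
  rw [lp.norm_eq_tsum_rpow (by norm_num), lp.norm_eq_tsum_rpow (by norm_num)]
  congr 1
  exact e.tsum_eq (fun x => ‖f x‖ ^ (2 : ℝ≥0∞).toReal)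

/-- Left translation `[λ(γ) f](x) = f(γ⁻¹ x)` as a unitary map of `ℓ²(Λ)`. -/
def leftTranslation {Λ : Type u} [Group Λ] (γ : Λ) : ellTwo Λ ≃ₗᵢ[ℂ] ellTwo Λ where
  toFun := ellTwoComp (Equiv.mulLeft γ⁻¹)
  invFun := ellTwoComp (Equiv.mulLeft γ)
  map_add' _ _ := rfl
  map_smul' _ _ := rfl
  left_inv f := by ext x; simp [ellTwoComp]
  right_inv f := by ext x; simp [ellTwoComp]
  norm_map' f := norm_ellTwoComp _ f

/-- The left regular representation `λ` of `Λ` on `ℓ²(Λ)`. -/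
def regRep (Λ : Type u) [Group Λ] : Λ →* unitary (ellTwo Λ →L[ℂ] ellTwo Λ) :=
  (Unitary.linearIsometryEquiv (𝕜 := ℂ) (H := ellTwo Λ)).symm.toMonoidHom.comp
    { toFun := leftTranslation
      map_one' := by
        ext f x
        change f ((1 : Λ)⁻¹ * x) = f x
        simp
      map_mul' := fun a b => by
        ext f x
        change f ((a * b)⁻¹ * x) = f (b⁻¹ * (a⁻¹ * x))
        rw [mul_inv_rev, mul_assoc] }

theorem regRep_apply {Λ : Type u} [Group Λ] (γ : Λ) (f : ellTwo Λ) (x : Λ) :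
    ((regRep Λ γ : ellTwo Λ →L[ℂ] ellTwo Λ) f) x = f (γ⁻¹ * x) := rfl

open Classical in
/-- The canonical trace `τ(a) = ⟨δ_e, a δ_e⟩`. -/
def canTrace {Λ : Type u} [Group Λ] (a : ellTwo Λ →L[ℂ] ellTwo Λ) : ℂ :=
  inner ℂ (lp.single 2 (1 : Λ) (1 : ℂ) : ellTwo Λ) (a (lp.single 2 (1 : Λ) (1 : ℂ)))

/-! ### The two assumptions -/

/-- The effective `1/n`-expansion of the expected spectral statistics of random unitary
representations `π n : Ω n → Hom(Λ, U(n))`, with constant `C` and coefficients `u k γ`: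
`u₀(γ) = τ(λ(γ))` and
`|E[ntr π_n(γ)] - ∑_{k<q} u_k(γ) n^{-k}| ≤ (Cq)^{Cq} n^{-q}` for `q ≥ |γ|`, `n ≥ C q^C`. -/
def EffectiveExpansion {Λ : Type u} [Group Λ] (S : Finset Λ)
    {Ω : ℕ → Type v} [∀ n, MeasurableSpace (Ω n)] (μ : ∀ n, MeasureTheory.Measure (Ω n))
    (π : ∀ n, Ω n → (Λ →* Matrix.unitaryGroup (Fin n) ℂ))
    (C : ℝ) (u : ℕ → Λ → ℝ) : Prop :=
  (∀ γ : Λ, (u 0 γ : ℂ) = canTrace (regRep Λ γ : ellTwo Λ →L[ℂ] ellTwo Λ)) ∧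
  ∀ (γ : Λ) (q n : ℕ), wordLength S γ ≤ q → 1 ≤ n → C * (q : ℝ) ^ C ≤ (n : ℝ) →
    ‖(∫ ω, ntr (π n ω γ : Matrix (Fin n) (Fin n) ℂ) ∂(μ n))
        - ∑ k ∈ Finset.range q, (u k γ : ℂ) / (n : ℂ) ^ k‖
      ≤ (C * q) ^ (C * q) / (n : ℝ) ^ q

/-- Temperedness of `f : Λ → ℝ` (extended linearly to the group algebra):
`limsup_{p → ∞} |f(x^p)|^{1/p} ≤ ‖λ(x)‖` for every self-adjoint `x`. The limsup is taken in
the extended reals, so no boundedness is presupposed. -/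
def Tempered {Λ : Type u} [Group Λ] (f : Λ → ℝ) : Prop :=
  ∀ x : MonoidAlgebra ℂ Λ, IsSelfAdj x →
    Filter.limsup (fun p : ℕ => ((‖linExt f (x ^ p)‖ ^ (1 / (p : ℝ)) : ℝ) : EReal))
        Filter.atTop
      ≤ ((‖repExt (regRep Λ) x‖ : ℝ) : EReal)

end GroupStrongConv

end

/-! The proof is the polynomial method with an asymptotic expansion. Let z have full norm at most 1
and degree at most Q. Its coefficients are at most 1 and its support has at most (3r)^Q elements, so
taking q = Q in assumption 1 shows that E ntr π_n(z) is close to a polynomial in 1/n of degree below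
Q, once n exceeds a threshold N that is linear in r and polynomial in Q. Since E ntr π_n(z) is also
bounded by 1, this polynomial is bounded at the points 1/n. Markov's inequality for polynomials then
bounds its Taylor coefficients and second derivative near 0. The result, `abs_second_order_le`, is E
ntr π_n(z) = u_0(z) + u_1(z)/n + O(r² Q^B / n²), uniformly in z.

To detect large eigenvalues, x is first replaced by y = g(x), where g comes from
`exists_threshold_polynomial`: it maps [-‖λ(x)‖, ‖λ(x)‖] into [0, 1/100] and every t with ‖λ(x)‖ + ε
≤ |t| ≤ K into [99/100, 1]. This turns the ε-gap into a universal one, at the price of a degree of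
order (K/ε)^4. A single family of test polynomials `testPoly m` then serves for all x. They are
nonnegative on [-1, 1], at least 1 on [99/100, 1] for large m, and their weighted Chebyshev
coefficient sums are bounded uniformly in m.

Summing the second order estimate over z = T_k(y) bounds the error on `testPoly m` independently of
m. The terms u_0 and u_1 vanish as m → ∞: by temperedness they have moments O(4^{-p}) on powers of
y, and the recursive form of the kernel turns such moment bounds into exponential decay in m
(`abs_map_cosPowPoly_le`). No extension of u_1 to smooth functions is needed. Markov's inequality
for probabilities, with the trace multiplied by n, leaves the bound O(r² D^B / n), where D bounds
the degree of y. -/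

noncomputable section

namespace GroupStrongConv

universe u v

/-! ### Markov's inequality and polynomials sampled at the points 1/n -/

section MarkovInequality

open Polynomial

/-- Markov's inequality at the right end point of `[-1, 1]`. -/
theorem abs_eval_derivative_one_le {P : ℝ[X]} {Q : ℕ} {M : ℝ} (hdeg : P.natDegree ≤ Q)
    (hM : 0 < M) (hP : ∀ t ∈ Set.Icc (-1 : ℝ) 1, |P.eval t| ≤ M) :
    |(derivative P).eval 1| ≤ (Q : ℝ) ^ 2 * M := by
  have hT : (derivative (Chebyshev.T ℝ Q)).eval 1 = (Q : ℝ) ^ 2 := by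
    rw [Chebyshev.T_derivative_eq_U]
    simp [Chebyshev.U_eval_one]
    ring
  -- The extremal property of Chebyshev polynomials is one-sided, so it is applied to both P/M and
  -- -P/M.
  have key : ∀ c : ℝ, |c| = M⁻¹ → c * (derivative P).eval 1 ≤ (Q : ℝ) ^ 2 := by
    intro c hc
    have h := Chebyshev.eval_iterate_derivative_le_of_forall_abs_le_one (n := Q) (P := C c * P)
      (k := 1) (x := 1) le_rfl
      ((natDegree_le_iff_degree_le).1 ((natDegree_C_mul_le _ _).trans hdeg)) (by
        intro t ht
        rw [eval_mul, eval_C, abs_mul, hc, inv_mul_le_iff₀ hM, mul_one]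
        exact hP t ht)
    simpa [hT] using h
  have h1 := key M⁻¹ (abs_of_pos (inv_pos.2 hM))
  have h2 := key (-M⁻¹) (by rw [abs_neg, abs_of_pos (inv_pos.2 hM)])
  rw [inv_mul_le_iff₀ hM] at h1
  rw [neg_mul, neg_le, ← neg_le_neg_iff, neg_neg, ← mul_neg, inv_mul_le_iff₀ hM] at h2
  rw [abs_le]
  constructor <;> linarith

/-- Markov's inequality at an end point of an arbitrary interval. -/
theorem abs_eval_derivative_endpoint_le {P : ℝ[X]} {Q : ℕ} {M p q : ℝ}
    (hdeg : P.natDegree ≤ Q) (hM : 0 < M)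
    (hP : ∀ t ∈ Set.uIcc p q, |P.eval t| ≤ M) :
    |p - q| * |(derivative P).eval p| ≤ 2 * (Q : ℝ) ^ 2 * M := by
  have h := abs_eval_derivative_one_le (P := P.comp (C ((p + q) / 2) + C ((p - q) / 2) * X))
    (Q := Q) (M := M) (by
      refine natDegree_comp_le.trans ?_
      have : (C ((p + q) / 2) + C ((p - q) / 2) * X).natDegree ≤ 1 := by compute_degree
      nlinarith) hM (by
      rintro t ⟨ht1, ht2⟩
      rw [eval_comp]
      apply hP
      simp only [eval_add, eval_C, eval_mul, eval_X]
      rw [Set.mem_uIcc]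
      rcases le_total p q with h | h
      · left; constructor <;> nlinarith
      · right; constructor <;> nlinarith)
  rw [derivative_comp] at h
  simp only [derivative_add, derivative_C, derivative_mul, derivative_X, eval_mul, eval_comp,
    eval_add, eval_C, eval_X, zero_add, zero_mul, mul_one] at h
  rw [show (p + q) / 2 + (p - q) / 2 = p by ring, abs_mul, abs_div] at h
  norm_num at h
  linarith

/-- Markov's inequality on `[0, δ]`, up to a constant factor. -/
theorem abs_eval_derivative_le {P : ℝ[X]} {Q : ℕ} {M δ : ℝ} (hdeg : P.natDegree ≤ Q)
    (hM : 0 < M) (hP : ∀ t ∈ Set.Icc 0 δ, |P.eval t| ≤ M) {t : ℝ}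
    (ht : t ∈ Set.Icc 0 δ) :
    δ * |(derivative P).eval t| ≤ 4 * (Q : ℝ) ^ 2 * M := by
  have h0 := abs_nonneg ((derivative P).eval t)
  -- The end point farther from t is at distance at least δ/2, which costs a factor 2.
  rcases le_total t (δ / 2) with h | h
  · have := abs_eval_derivative_endpoint_le (p := t) (q := δ) hdeg hM (fun s hs => hP s (by
      rw [Set.uIcc_of_le ht.2] at hs; exact ⟨ht.1.trans hs.1, hs.2⟩))
    rw [abs_sub_comm, abs_of_nonneg (by linarith [ht.2])] at this
    nlinarith
  · have := abs_eval_derivative_endpoint_le (p := t) (q := 0) hdeg hM (fun s hs => hP s (by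
      rw [Set.uIcc_of_ge ht.1] at hs; exact ⟨hs.1, hs.2.trans ht.2⟩))
    rw [sub_zero, abs_of_nonneg ht.1] at this
    nlinarith

theorem abs_eval_sub_eval_le {P : ℝ[X]} {B δ s t : ℝ}
    (hP : ∀ t ∈ Set.Icc 0 δ, |(derivative P).eval t| ≤ B)
    (hs : s ∈ Set.Icc 0 δ) (ht : t ∈ Set.Icc 0 δ) :
    |P.eval t - P.eval s| ≤ B * |t - s| := by
  have := (convex_Icc (0 : ℝ) δ).norm_image_sub_le_of_norm_deriv_le (f := fun x => P.eval x)
    (C := B) (x := s) (y := t) (fun x _ => P.differentiableAt) (by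
      intro x hx
      rw [Polynomial.deriv]
      exact hP x hx) hs ht
  simpa using this

/-- Consecutive reciprocals beyond N differ by at most 1/N². The gap next to 0 needs its own
witness, N². -/
theorem exists_nat_abs_sub_inv_le {N : ℕ} (hN : 1 ≤ N) {t : ℝ} (ht : t ∈ Set.Icc 0 (1 / (N : ℝ))) :
    ∃ n : ℕ, N ≤ n ∧ |t - 1 / (n : ℝ)| ≤ 1 / (N : ℝ) ^ 2 := by
  have hN' : (1 : ℝ) ≤ N := by exact_mod_cast hN
  rcases ht.1.eq_or_lt with h0 | h0
  · refine ⟨N ^ 2, Nat.le_self_pow (by norm_num) N, ?_⟩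
    rw [← h0, zero_sub, abs_neg, abs_of_nonneg (by positivity)]
    push_cast
    exact le_rfl
  · have h1 : (N : ℝ) ≤ 1 / t := by
      rw [le_div_iff₀ h0, mul_comm, ← le_div_iff₀ (by linarith)]
      exact ht.2
    have h2 : N ≤ ⌊1 / t⌋₊ := Nat.le_floor h1
    refine ⟨⌊1 / t⌋₊, h2, ?_⟩
    set n := ⌊1 / t⌋₊
    have h3 : (n : ℝ) ≤ 1 / t := Nat.floor_le (by positivity)
    have h4 : 1 / t < n + 1 := Nat.lt_floor_add_one _
    have h2' : (N : ℝ) ≤ n := by exact_mod_cast h2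
    have hn : (0 : ℝ) < n := by linarith
    rw [le_div_iff₀ h0] at h3
    rw [div_lt_iff₀ h0] at h4
    have h5 : t ≤ 1 / n := by rw [le_div_iff₀ hn]; linarith
    rw [abs_sub_comm, abs_of_nonneg (by linarith), sub_le_iff_le_add, div_le_iff₀ hn]
    have h6 : (n : ℝ) * (1 / (N : ℝ) ^ 2) ≥ 1 / n := by
      rw [mul_one_div, ge_iff_le, div_le_div_iff₀ hn (by positivity)]
      nlinarith
    have h7 : t ≤ 1 / n := h5
    nlinarith

/-- A polynomial that is bounded at the points `1 / n` with `n ≥ N` is bounded on `[0, 1 / N]`,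
when `N` is large compared with the square of the degree. -/
theorem abs_eval_le_of_abs_eval_inv_nat_le {P : ℝ[X]} {Q N : ℕ} {b : ℝ}
    (hdeg : P.natDegree ≤ Q) (hN : 1 ≤ N) (hNQ : 8 * Q ^ 2 ≤ N)
    (hP : ∀ n : ℕ, N ≤ n → |P.eval (1 / (n : ℝ))| ≤ b)
    {t : ℝ} (ht : t ∈ Set.Icc 0 (1 / (N : ℝ))) : |P.eval t| ≤ 2 * b := by
  have hN' : (1 : ℝ) ≤ N := by exact_mod_cast hN
  have hNQ' : 8 * (Q : ℝ) ^ 2 ≤ N := by exact_mod_cast hNQ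
  obtain ⟨s, hs, hmax⟩ := isCompact_Icc.exists_isMaxOn
    (Set.nonempty_Icc.2 (by positivity : (0 : ℝ) ≤ 1 / N))
    (f := fun t => |P.eval t|) P.continuous.abs.continuousOn
  refine (hmax ht).trans ?_
  change |P.eval s| ≤ 2 * b
  have hb : 0 ≤ b := (abs_nonneg _).trans (hP N le_rfl)
  rcases (abs_nonneg (P.eval s)).eq_or_lt with h0 | h0
  · rw [← h0]; positivity
  set M := |P.eval s| with hMdef
  obtain ⟨n, hn, hsn⟩ := exists_nat_abs_sub_inv_le hN hs
  have hn' : (N : ℝ) ≤ n := by exact_mod_cast hn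
  have h1 := abs_eval_sub_eval_le (P := P) (B := N * (4 * (Q : ℝ) ^ 2 * M)) (δ := 1 / N)
    (s := 1 / n) (t := s) (by
      intro u hu
      have := abs_eval_derivative_le hdeg h0 (fun t ht => hmax ht) hu
      rw [one_div, inv_mul_le_iff₀ (by linarith)] at this
      exact this) ⟨by positivity, one_div_le_one_div_of_le (by linarith) hn'⟩ hs
  have h2 : M ≤ |P.eval (1 / (n : ℝ))| + |P.eval s - P.eval (1 / (n : ℝ))| := by
    have := abs_add_le (P.eval (1 / (n : ℝ))) (P.eval s - P.eval (1 / (n : ℝ)))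
    rwa [add_sub_cancel] at this
  -- By 8Q² ≤ N, moving from the maximum point to a nearby sample loses at most half of the maximum.
  have h3 : N * (4 * (Q : ℝ) ^ 2 * M) * |s - 1 / n| ≤ M / 2 := by
    calc N * (4 * (Q : ℝ) ^ 2 * M) * |s - 1 / n| ≤ N * (4 * (Q : ℝ) ^ 2 * M) * (1 / (N : ℝ) ^ 2) := by
          gcongr
      _ = 4 * (Q : ℝ) ^ 2 * M / N := by field_simp
      _ ≤ M / 2 := by
          rw [div_le_div_iff₀ (by linarith) (by norm_num)]
          nlinarith
  have := hP n hn
  linarith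

/-- Bounds on the first order Taylor expansion at `0` of a polynomial that is bounded at the
points `1 / n`. -/
theorem taylor_bounds_of_abs_eval_inv_nat_le {P : ℝ[X]} {Q N : ℕ}
    (hdeg : P.natDegree ≤ Q) (hQ : 1 ≤ Q) (hNQ : 8 * Q ^ 2 ≤ N)
    (hP : ∀ n : ℕ, N ≤ n → |P.eval (1 / (n : ℝ))| ≤ 2) :
    |P.coeff 0| ≤ 4 ∧ |P.coeff 1| ≤ 16 * (Q : ℝ) ^ 2 * N ∧
    ∀ t ∈ Set.Icc 0 (1 / (N : ℝ)),
      |P.eval t - P.coeff 0 - P.coeff 1 * t| ≤ 64 * (Q : ℝ) ^ 4 * N ^ 2 * t ^ 2 := by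
  have hN : 1 ≤ N := by nlinarith
  have hN' : (1 : ℝ) ≤ N := by exact_mod_cast hN
  have hQ' : (1 : ℝ) ≤ Q := by exact_mod_cast hQ
  have hz : (0 : ℝ) ∈ Set.Icc 0 (1 / (N : ℝ)) := ⟨le_rfl, by positivity⟩
  have b0 : ∀ t ∈ Set.Icc 0 (1 / (N : ℝ)), |P.eval t| ≤ 4 := fun t ht => by
    have := abs_eval_le_of_abs_eval_inv_nat_le hdeg hN hNQ hP ht
    linarith
  have b1 : ∀ t ∈ Set.Icc 0 (1 / (N : ℝ)), |(derivative P).eval t| ≤ 16 * (Q : ℝ) ^ 2 * N := by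
    intro t ht
    have := abs_eval_derivative_le hdeg (by norm_num) b0 ht
    rw [one_div, inv_mul_le_iff₀ (by linarith)] at this
    linarith
  have b2 : ∀ t ∈ Set.Icc 0 (1 / (N : ℝ)),
      |(derivative (derivative P)).eval t| ≤ 64 * (Q : ℝ) ^ 4 * N ^ 2 := by
    intro t ht
    have := abs_eval_derivative_le (Q := Q) ((natDegree_derivative_le P).trans (by omega))
      (by positivity) b1 ht
    rw [one_div, inv_mul_le_iff₀ (by linarith)] at this
    linarith
  have e0 : P.coeff 0 = P.eval 0 := coeff_zero_eq_eval_zero P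
  have e1 : P.coeff 1 = (derivative P).eval 0 := by
    rw [← coeff_zero_eq_eval_zero, coeff_derivative]; simp
  refine ⟨e0 ▸ b0 0 hz, e1 ▸ b1 0 hz, fun t ht => ?_⟩
  have c1 : ∀ s ∈ Set.Icc 0 t, |(derivative (P - C (P.coeff 1) * X)).eval s|
      ≤ 64 * (Q : ℝ) ^ 4 * N ^ 2 * t := by
    intro s hs
    have hs' : s ∈ Set.Icc 0 (1 / (N : ℝ)) := ⟨hs.1, hs.2.trans ht.2⟩
    have := abs_eval_sub_eval_le b2 hz hs'
    simp only [derivative_sub, derivative_mul, derivative_C, derivative_X, eval_sub, eval_C,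
      zero_mul, zero_add, mul_one]
    rw [e1]
    refine this.trans ?_
    rw [sub_zero, abs_of_nonneg hs.1]
    gcongr
    exact hs.2
  have := abs_eval_sub_eval_le c1 (⟨le_rfl, ht.1⟩ : (0 : ℝ) ∈ Set.Icc 0 t) ⟨ht.1, le_rfl⟩
  simp only [eval_sub, eval_mul, eval_C, eval_X, mul_zero, sub_zero, abs_of_nonneg ht.1] at this
  rw [e0]
  calc _ = |P.eval t - P.coeff 1 * t - P.eval 0| := by ring_nf
    _ ≤ _ := this
    _ = _ := by ring

end MarkovInequality

/-! ### Test polynomials from the de la Vallée-Poussin kernel -/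

section TestPolynomials

open Polynomial MeasureTheory

/-- The normalized binomial weights: the Fourier coefficients of the de la Vallée-Poussin kernel. -/
def binomWeight (m j : ℕ) : ℝ := ((2 * m).choose j : ℝ) / (m.centralBinom : ℝ)

theorem binomWeight_nonneg (m j : ℕ) : 0 ≤ binomWeight m j := by
  unfold binomWeight; positivity

theorem binomWeight_le_one (m j : ℕ) : binomWeight m j ≤ 1 := by
  unfold binomWeight
  refine div_le_one_of_le₀ ?_ (by positivity)
  exact_mod_cast Nat.choose_le_centralBinom j m

/-- Real part of the binomial expansion of (e^{iψ} + 1)^{2m} e^{-imψ} = (2(1 + cos ψ))^m. -/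
theorem sum_binomWeight_mul_cos (m : ℕ) (ψ : ℝ) :
    ∑ j ∈ Finset.range (2 * m + 1), binomWeight m j * Real.cos (((j : ℤ) - m : ℤ) * ψ)
      = 2 ^ m / m.centralBinom * (1 + Real.cos ψ) ^ m := by
  have h : ∑ j ∈ Finset.range (2 * m + 1), (((2 * m).choose j : ℝ) : ℂ) *
      Complex.exp (((((j : ℤ) - m : ℤ) * ψ : ℝ) : ℂ) * Complex.I)
        = (((2 * (1 + Real.cos ψ)) ^ m : ℝ) : ℂ) := by
    have h1 : ((2 * (1 + Real.cos ψ) : ℝ) : ℂ)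
        = (Complex.exp (ψ * Complex.I) + 1) ^ 2 * Complex.exp (-(ψ * Complex.I)) := by
      push_cast
      rw [Complex.cos]
      have e1 : Complex.exp (ψ * Complex.I) * Complex.exp (-(ψ * Complex.I)) = 1 := by
        rw [← Complex.exp_add, add_neg_cancel, Complex.exp_zero]
      rw [neg_mul]
      linear_combination (-Complex.exp (ψ * Complex.I) - 2) * e1
    rw [Complex.ofReal_pow, h1, mul_pow, ← pow_mul, add_pow, Finset.sum_mul]
    refine Finset.sum_congr rfl fun j _ => ?_
    rw [one_pow, mul_one, ← Complex.exp_nat_mul, ← Complex.exp_nat_mul]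
    rw [mul_right_comm, ← Complex.exp_add, mul_comm]
    push_cast
    ring_nf
  have h2 := congrArg Complex.re h
  rw [Complex.ofReal_re, Complex.re_sum] at h2
  rw [div_mul_eq_mul_div, ← mul_pow, ← h2, Finset.sum_div]
  refine Finset.sum_congr rfl fun j _ => ?_
  rw [Complex.re_ofReal_mul, Complex.exp_ofReal_mul_I_re, binomWeight]
  ring

/-- The symmetrized de la Vallée-Poussin kernel, as a polynomial in the cosine. -/
def kernelPoly (m : ℕ) (φ : ℝ) : ℝ[X] :=
  ∑ j ∈ Finset.range (2 * m + 1),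
    (binomWeight m j * Real.cos (((j : ℤ) - m : ℤ) * φ)) • Chebyshev.T ℝ ((j : ℤ) - m)

theorem eval_kernelPoly (m : ℕ) (φ θ : ℝ) :
    (kernelPoly m φ).eval (Real.cos θ) = 2 ^ m / m.centralBinom *
      (((1 + Real.cos (θ - φ)) ^ m + (1 + Real.cos (θ + φ)) ^ m) / 2) := by
  rw [kernelPoly, eval_finsetSum, mul_div_assoc', mul_add, ← sum_binomWeight_mul_cos,
    ← sum_binomWeight_mul_cos, ← Finset.sum_add_distrib, Finset.sum_div]
  refine Finset.sum_congr rfl fun j _ => ?_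
  rw [eval_smul, Chebyshev.T_real_cos, smul_eq_mul, mul_sub, mul_add, Real.cos_sub, Real.cos_add]
  ring

/-- With `a± = 1 + cos φ cos θ ± sin φ sin θ`, the polynomials in `cos θ` that represent
`(a₊ ^ m + a₋ ^ m) / 2` and `(a₊ ^ m - a₋ ^ m) / (2 sin φ sin θ)`. -/
def cosPowPoly (φ : ℝ) : ℕ → ℝ[X] × ℝ[X]
  | 0 => (1, 0)
  | m + 1 =>
    ((cosPowPoly φ m).1 + Real.cos φ • (X * (cosPowPoly φ m).1)
        + Real.sin φ ^ 2 • ((cosPowPoly φ m).2 - X * (X * (cosPowPoly φ m).2)),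
      (cosPowPoly φ m).1 + (cosPowPoly φ m).2 + Real.cos φ • (X * (cosPowPoly φ m).2))

/-- The recursion multiplies A ± sin φ sin θ · B by 1 + cos φ cos θ ± sin φ sin θ and replaces sin²
θ by 1 - cos² θ. -/
theorem eval_cosPowPoly (φ θ : ℝ) (m : ℕ) :
    (cosPowPoly φ m).1.eval (Real.cos θ)
        + Real.sin φ * Real.sin θ * (cosPowPoly φ m).2.eval (Real.cos θ)
      = (1 + Real.cos (θ - φ)) ^ m ∧
    (cosPowPoly φ m).1.eval (Real.cos θ)
        - Real.sin φ * Real.sin θ * (cosPowPoly φ m).2.eval (Real.cos θ)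
      = (1 + Real.cos (θ + φ)) ^ m := by
  induction m with
  | zero => simp [cosPowPoly]
  | succ m ih =>
    have h := Real.sin_sq_add_cos_sq θ
    rw [pow_succ, pow_succ, ← ih.1, ← ih.2, Real.cos_sub, Real.cos_add]
    simp only [cosPowPoly, eval_add, eval_smul, eval_mul, eval_X, eval_sub, smul_eq_mul]
    constructor
    · linear_combination (-Real.sin φ ^ 2 * (cosPowPoly φ m).2.eval (Real.cos θ)) * h
    · linear_combination (-Real.sin φ ^ 2 * (cosPowPoly φ m).2.eval (Real.cos θ)) * h

/-- The Chebyshev form of the kernel suits the second order expansion; the recursive form suits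
functionals known only through their moments. -/
theorem kernelPoly_eq (m : ℕ) (φ : ℝ) :
    kernelPoly m φ = ((2 : ℝ) ^ m / m.centralBinom) • (cosPowPoly φ m).1 := by
  refine eq_of_infinite_eval_eq _ _ (Set.Infinite.mono ?_ (Set.Icc_infinite (by norm_num : (-1 : ℝ) < 1)))
  intro s hs
  rw [Set.mem_ofPred_eq, ← Real.cos_arccos hs.1 hs.2, eval_kernelPoly, eval_smul, smul_eq_mul]
  obtain ⟨h1, h2⟩ := eval_cosPowPoly φ (Real.arccos s) m
  congr 1
  rw [← h1, ← h2]
  ring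

/-- Multiplication by X inside L yields a functional of the same kind with M/4 in place of M, hence
an induction over all L. With sin² φ ≤ 1/4, the ratio 8/5 and rate 15/8 are matched to the second
recursion: 1 + (8/5)(5/4) = 3 = (15/8)(8/5). What matters is 15/8 < 2. -/
theorem abs_map_cosPowPoly_le {φ : ℝ} (hφ : Real.sin φ ^ 2 ≤ 1 / 4) (m : ℕ) :
    ∀ (L : ℝ[X] →ₗ[ℝ] ℝ) (M : ℝ), (∀ p : ℕ, |L (X ^ p)| ≤ M * (1 / 4) ^ p) →
      |L (cosPowPoly φ m).1| ≤ M * (15 / 8) ^ m ∧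
      |L (cosPowPoly φ m).2| ≤ M * (15 / 8) ^ m * (8 / 5) := by
  induction m with
  | zero =>
    intro L M hL
    have := hL 0
    have h0 := (abs_nonneg _).trans this
    simp only [pow_zero, mul_one, cosPowPoly, map_zero, abs_zero] at *
    exact ⟨this, by linarith⟩
  | succ m ih =>
    intro L M hL
    have shift : ∀ (L : ℝ[X] →ₗ[ℝ] ℝ) (M : ℝ), (∀ p : ℕ, |L (X ^ p)| ≤ M * (1 / 4) ^ p) →
        ∀ p : ℕ, |(L.comp (LinearMap.mulLeft ℝ X)) (X ^ p)| ≤ (M / 4) * (1 / 4) ^ p := by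
      intro L M hL p
      have := hL (p + 1)
      rw [LinearMap.comp_apply, LinearMap.mulLeft_apply, ← pow_succ']
      refine this.trans (le_of_eq ?_)
      ring
    have h1 := shift L M hL
    have h2 := shift _ _ h1
    obtain ⟨a0, b0⟩ := ih L M hL
    obtain ⟨a1, b1⟩ := ih _ _ h1
    obtain ⟨-, b2⟩ := ih _ _ h2
    simp only [LinearMap.comp_apply, LinearMap.mulLeft_apply] at a1 b1 b2
    set E := (15 / 8 : ℝ) ^ m
    have hc := Real.abs_cos_le_one φ
    have hME : 0 ≤ M * E := (abs_nonneg _).trans a0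
    have mulc : ∀ {y z : ℝ}, |y| ≤ z → |Real.cos φ * y| ≤ z := by
      intro y z hy
      rw [abs_mul]
      exact (mul_le_of_le_one_left (abs_nonneg _) hc).trans hy
    have muls : ∀ {y z : ℝ}, |y| ≤ z → |Real.sin φ ^ 2 * y| ≤ z / 4 := by
      intro y z hy
      rw [abs_mul, abs_of_nonneg (sq_nonneg (Real.sin φ))]
      nlinarith [abs_nonneg y, sq_nonneg (Real.sin φ)]
    have mc1 := mulc a1
    have mc2 := mulc b1
    have ms1 := muls b0
    have ms2 := muls b2
    rw [pow_succ]
    change _ ≤ M * (E * (15 / 8)) ∧ _ ≤ M * (E * (15 / 8)) * (8 / 5)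
    simp only [cosPowPoly, map_add, map_smul, map_sub, smul_eq_mul, mul_sub]
    rw [abs_le] at *
    refine ⟨?_, abs_le.2 ?_⟩ <;> constructor <;> linarith

theorem two_pow_div_centralBinom_le {m : ℕ} (hm : 0 < m) :
    (2 : ℝ) ^ m / m.centralBinom ≤ 2 * m * (1 / 2) ^ m := by
  have h := Nat.four_pow_le_two_mul_self_mul_centralBinom m hm
  have h' : (4 : ℝ) ^ m ≤ 2 * m * m.centralBinom := by exact_mod_cast h
  have hc : (0 : ℝ) < m.centralBinom := by exact_mod_cast Nat.centralBinom_pos m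
  rw [div_le_iff₀ hc]
  calc (2 : ℝ) ^ m = 4 ^ m * (1 / 2) ^ m := by rw [← mul_pow]; norm_num
    _ ≤ 2 * m * m.centralBinom * (1 / 2) ^ m := by gcongr
    _ = _ := by ring

theorem tendsto_two_mul_self_mul_pow {q : ℝ} (h0 : 0 ≤ q) (h1 : q < 1) :
    Filter.Tendsto (fun m : ℕ => 2 * (m : ℝ) * q ^ m) Filter.atTop (nhds 0) := by
  have := (tendsto_self_mul_const_pow_of_lt_one h0 h1).const_mul 2
  simpa [mul_assoc] using this

/-- A fixed smooth bump in the angle. -/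
def angleBump : ContDiffBump (0 : ℝ) where
  -- The outer radius ensures sin² φ ≤ 1/4 on the support; the inner one is 1/4 + 1/8, to contain
  -- the 1/8-neighbourhood of every angle |θ| ≤ 1/4.
  rIn := 3 / 8
  rOut := 1 / 2
  rIn_pos := by norm_num
  rIn_lt_rOut := by norm_num

/-- The Fourier cosine coefficients of `angleBump`. -/
def bumpCoeff (k : ℤ) : ℝ := ∫ φ, angleBump φ * Real.cos (k * φ)

theorem integrable_angleBump_mul {h : ℝ → ℝ} (hh : Continuous h) :
    Integrable fun φ => angleBump φ * h φ :=
  (angleBump.continuous.mul hh).integrable_of_hasCompactSupport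
    angleBump.hasCompactSupport.mul_right

/-- The test polynomials: regularizations of the bump `angleBump`, seen as a function of the
cosine of the angle. -/
def testPoly (m : ℕ) : ℝ[X] :=
  ∑ j ∈ Finset.range (2 * m + 1),
    (binomWeight m j * bumpCoeff ((j : ℤ) - m)) • Chebyshev.T ℝ ((j : ℤ) - m)

/-- The test polynomial is the average of the kernels over φ against the bump. The kernel is a
finite sum, so L passes through the integral without any continuity. -/
theorem map_testPoly (L : ℝ[X] →ₗ[ℝ] ℝ) (m : ℕ) :
    L (testPoly m) = ∫ φ, angleBump φ * L (kernelPoly m φ) := by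
  simp only [testPoly, kernelPoly, map_sum, map_smul, smul_eq_mul, Finset.mul_sum]
  rw [integral_finsetSum _ (fun j _ => integrable_angleBump_mul (by fun_prop))]
  refine Finset.sum_congr rfl fun j _ => ?_
  rw [bumpCoeff, mul_right_comm, ← integral_const_mul]
  congr 1
  ext φ
  ring

theorem abs_lt_of_angleBump_ne_zero {φ : ℝ} (h : angleBump φ ≠ 0) : |φ| < 1 / 2 := by
  have : φ ∈ Function.support angleBump := h
  rw [angleBump.support_eq, Metric.mem_ball, dist_zero_right] at this
  exact this

/-- The kernel's normalization is at most 2m · 2^{-m}, which beats the growth (15/8)^m of the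
unnormalized kernel. -/
theorem abs_map_testPoly_le (L : ℝ[X] →ₗ[ℝ] ℝ) {M : ℝ}
    (hL : ∀ p : ℕ, |L (X ^ p)| ≤ M * (1 / 4) ^ p) {m : ℕ} (hm : 0 < m) :
    |L (testPoly m)| ≤ (∫ φ, angleBump φ) * M * (2 * m * (15 / 16) ^ m) := by
  have hM : 0 ≤ M := by simpa using (abs_nonneg _).trans (hL 0)
  rw [map_testPoly, mul_assoc, ← integral_mul_const, ← Real.norm_eq_abs]
  refine norm_integral_le_of_norm_le ?_ (Filter.Eventually.of_forall fun φ => ?_)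
  · exact integrable_angleBump_mul continuous_const
  · rw [norm_mul, Real.norm_of_nonneg angleBump.nonneg]
    by_cases hφ : angleBump φ = 0
    · rw [hφ, zero_mul, zero_mul]
    · refine mul_le_mul_of_nonneg_left ?_ angleBump.nonneg
      have h1 := abs_lt_of_angleBump_ne_zero hφ
      have h2 : Real.sin φ ^ 2 ≤ 1 / 4 := by
        have := Real.abs_sin_le_abs (x := φ)
        rw [← sq_abs]
        nlinarith [abs_nonneg (Real.sin φ)]
      have h3 := (abs_map_cosPowPoly_le h2 m L M hL).1
      rw [kernelPoly_eq, map_smul, smul_eq_mul, norm_mul, Real.norm_of_nonneg (by positivity),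
        Real.norm_eq_abs]
      calc _ ≤ 2 * m * (1 / 2) ^ m * (M * (15 / 8) ^ m) := by
            gcongr
            exact two_pow_div_centralBinom_le hm
        _ = M * (2 * m * (15 / 16) ^ m) := by
            rw [show (15 / 16 : ℝ) = (1 / 2) * (15 / 8) by norm_num, mul_pow]; ring

theorem tendsto_map_testPoly (L : ℝ[X] →ₗ[ℝ] ℝ) {M : ℝ}
    (hL : ∀ p : ℕ, |L (X ^ p)| ≤ M * (1 / 4) ^ p) :
    Filter.Tendsto (fun m => L (testPoly m)) Filter.atTop (nhds 0) := by
  refine squeeze_zero_norm' ?_ (by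
    simpa using (tendsto_two_mul_self_mul_pow (q := 15 / 16) (by norm_num)
      (by norm_num)).const_mul ((∫ φ, angleBump φ) * M))
  filter_upwards [Filter.eventually_gt_atTop 0] with m hm
  exact abs_map_testPoly_le L hL hm

theorem eval_testPoly (m : ℕ) (θ : ℝ) :
    (testPoly m).eval (Real.cos θ) = ∫ φ, angleBump φ * (2 ^ m / m.centralBinom *
      (((1 + Real.cos (θ - φ)) ^ m + (1 + Real.cos (θ + φ)) ^ m) / 2)) := by
  have := map_testPoly (Polynomial.leval (Real.cos θ)) m
  simpa only [Polynomial.leval_apply, eval_kernelPoly] using this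

theorem one_add_cos_nonneg (x : ℝ) : 0 ≤ 1 + Real.cos x := by
  linarith [Real.neg_one_le_cos x]

theorem eval_testPoly_nonneg (m : ℕ) {s : ℝ} (hs : s ∈ Set.Icc (-1 : ℝ) 1) :
    0 ≤ (testPoly m).eval s := by
  rw [← Real.cos_arccos hs.1 hs.2, eval_testPoly]
  refine integral_nonneg fun φ => mul_nonneg angleBump.nonneg ?_
  have h1 := one_add_cos_nonneg (Real.arccos s - φ)
  have h2 := one_add_cos_nonneg (Real.arccos s + φ)
  positivity

end TestPolynomials

/-! ### Coefficient decay and lower bounds for the test polynomials -/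

section TestPolynomialBounds

open Polynomial MeasureTheory

/-- The coefficients are real parts of the Fourier transform of a Schwartz function at k/(2π). -/
theorem exists_abs_bumpCoeff_mul_pow_le (N : ℕ) :
    ∃ A : ℝ, ∀ k : ℤ, |bumpCoeff k| * ((k.natAbs : ℝ) + 1) ^ N ≤ A := by
  have hcs : HasCompactSupport (fun φ => (angleBump φ : ℂ)) :=
    angleBump.hasCompactSupport.comp_left (g := fun x : ℝ => (x : ℂ)) rfl
  have hsm : ContDiff ℝ ((⊤ : ℕ∞) : WithTop ℕ∞) (fun φ => (angleBump φ : ℂ)) :=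
    Complex.ofRealCLM.contDiff.comp angleBump.contDiff
  obtain ⟨F, hF⟩ : ∃ F : SchwartzMap ℝ ℂ, ∀ φ, F φ = (angleBump φ : ℂ) :=
    ⟨hcs.toSchwartzMap hsm, fun _ => rfl⟩
  obtain ⟨D, hdecay⟩ : ∃ D : ℝ, ∀ ξ : ℝ,
      (1 + |ξ|) ^ N * ‖FourierTransform.fourier (F : ℝ → ℂ) ξ‖ ≤ D := by
    have := fun ξ : ℝ => SchwartzMap.one_add_le_sup_seminorm_apply (𝕜 := ℝ) (m := (N, 0)) (k := N)
      (n := 0) le_rfl le_rfl (FourierTransform.fourier F) ξ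
    simp only [norm_iteratedFDeriv_zero, Real.norm_eq_abs, SchwartzMap.fourier_coe] at this
    exact ⟨_, this⟩
  have hre : ∀ k : ℤ,
      bumpCoeff k = (FourierTransform.fourier (F : ℝ → ℂ) (k / (2 * Real.pi))).re := by
    intro k
    have hint : Integrable fun φ : ℝ =>
        Complex.exp (((-2 * Real.pi * φ * (k / (2 * Real.pi)) : ℝ) : ℂ) * Complex.I)
          * (angleBump φ : ℂ) := by
      refine Continuous.integrable_of_hasCompactSupport ?_ hcs.mul_left
      exact Continuous.mul (by fun_prop) hsm.continuous
    rw [Real.fourier_real_eq_integral_exp_smul]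
    simp_rw [hF, smul_eq_mul]
    rw [bumpCoeff, ← RCLike.re_eq_complex_re, ← integral_re hint]
    refine integral_congr_ae (Filter.Eventually.of_forall fun φ => ?_)
    dsimp only
    rw [RCLike.re_eq_complex_re, mul_comm (Complex.exp _), Complex.re_ofReal_mul,
      Complex.exp_ofReal_mul_I_re]
    have : -2 * Real.pi * φ * (k / (2 * Real.pi)) = -(k * φ) := by
      field_simp
    rw [this, Real.cos_neg]
  refine ⟨(2 * Real.pi) ^ N * D, fun k => ?_⟩
  have hpi := Real.two_le_pi
  have h1 : ((k.natAbs : ℝ) + 1) ≤ 2 * Real.pi * (1 + |(k : ℝ) / (2 * Real.pi)|) := by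
    rw [abs_div, abs_of_pos (by positivity : 0 < 2 * Real.pi), mul_add, mul_div_cancel₀ _ (by positivity),
      Nat.cast_natAbs, Int.cast_abs]
    linarith
  calc |bumpCoeff k| * ((k.natAbs : ℝ) + 1) ^ N
      ≤ ‖FourierTransform.fourier (F : ℝ → ℂ) (k / (2 * Real.pi))‖ * (2 * Real.pi * (1 + |(k : ℝ) / (2 * Real.pi)|)) ^ N := by
        gcongr
        rw [hre]
        exact Complex.abs_re_le_norm _
    _ = (2 * Real.pi) ^ N * ((1 + |(k : ℝ) / (2 * Real.pi)|) ^ N * ‖FourierTransform.fourier (F : ℝ → ℂ) (k / (2 * Real.pi))‖) := by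
        rw [mul_pow]; ring
    _ ≤ _ := by gcongr; exact hdecay _

theorem summable_abs_bumpCoeff_mul_pow (B : ℕ) :
    Summable fun k : ℤ => |bumpCoeff k| * ((k.natAbs : ℝ) + 1) ^ B := by
  obtain ⟨A, hA⟩ := exists_abs_bumpCoeff_mul_pow_le (B + 2)
  have hs : Summable fun n : ℕ => A * (1 / ((n : ℝ) + 1) ^ 2) := by
    refine Summable.mul_left A ?_
    have := (summable_nat_add_iff (f := fun n : ℕ => 1 / (n : ℝ) ^ 2) 1).2
      (Real.summable_one_div_nat_pow.2 (by norm_num))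
    simpa using this
  have hk : ∀ k : ℤ, |bumpCoeff k| * ((k.natAbs : ℝ) + 1) ^ B
      ≤ A * (1 / ((k.natAbs : ℝ) + 1) ^ 2) := by
    intro k
    rw [mul_one_div, le_div_iff₀ (by positivity), mul_assoc, ← pow_add]
    exact hA k
  have hs' : Summable fun k : ℤ => A * (1 / ((k.natAbs : ℝ) + 1) ^ 2) := by
    refine Summable.of_nat_of_neg ?_ ?_ <;> simpa using hs
  exact Summable.of_nonneg_of_le (fun k => by positivity) hk hs'

/-- Regularization only multiplies the bump's coefficients by weights in [0, 1], so the full series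
bounds every m at once. -/
theorem exists_sum_testPoly_coeff_le (B : ℕ) :
    ∃ A : ℝ, 0 < A ∧ ∀ m : ℕ, ∑ j ∈ Finset.range (2 * m + 1),
      |binomWeight m j * bumpCoeff ((j : ℤ) - m)| * ((((j : ℤ) - m).natAbs : ℝ) + 1) ^ B ≤ A := by
  have hs := summable_abs_bumpCoeff_mul_pow B
  refine ⟨(∑' k : ℤ, |bumpCoeff k| * ((k.natAbs : ℝ) + 1) ^ B) + 1,
    add_pos_of_nonneg_of_pos (tsum_nonneg fun k => by positivity) one_pos, fun m => ?_⟩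
  have hinj : Function.Injective fun j : ℕ => (j : ℤ) - m := by
    intro a b h
    simpa using h
  calc _ ≤ ∑ j ∈ Finset.range (2 * m + 1),
        |bumpCoeff ((j : ℤ) - m)| * ((((j : ℤ) - m).natAbs : ℝ) + 1) ^ B := by
        refine Finset.sum_le_sum fun j _ => ?_
        refine mul_le_mul_of_nonneg_right ?_ (by positivity)
        rw [abs_mul, abs_of_nonneg (binomWeight_nonneg m j)]
        exact mul_le_of_le_one_left (abs_nonneg _) (binomWeight_le_one m j)
    _ = ∑ k ∈ (Finset.range (2 * m + 1)).map ⟨_, hinj⟩,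
        |bumpCoeff k| * ((k.natAbs : ℝ) + 1) ^ B := by
        rw [Finset.sum_map]; rfl
    _ ≤ ∑' k : ℤ, |bumpCoeff k| * ((k.natAbs : ℝ) + 1) ^ B :=
        hs.sum_le_tsum _ fun k _ => by positivity
    _ ≤ _ := by linarith

/-- Only the constant Fourier mode j = m survives integration over a period, and its weight is 1. -/
theorem integral_cosPow_kernel (m : ℕ) :
    2 ^ m / (m.centralBinom : ℝ) * ∫ ψ in (-Real.pi)..Real.pi, (1 + Real.cos ψ) ^ m
      = 2 * Real.pi := by
  rw [← intervalIntegral.integral_const_mul]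
  simp_rw [← sum_binomWeight_mul_cos]
  rw [intervalIntegral.integral_finsetSum
    (fun j _ => Continuous.intervalIntegrable (by fun_prop) _ _)]
  rw [Finset.sum_eq_single_of_mem m (by simp; omega)]
  · have : binomWeight m m = 1 := by
      rw [binomWeight, Nat.centralBinom, div_self]
      exact_mod_cast (Nat.centralBinom_pos m).ne'
    simp [this]
    ring
  · intro j _ hj
    rw [intervalIntegral.integral_const_mul]
    have hk : ((((j : ℤ) - m : ℤ)) : ℝ) ≠ 0 := by
      rw [Int.cast_ne_zero, sub_ne_zero]
      exact_mod_cast hj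
    rw [intervalIntegral.integral_comp_mul_left (fun x => Real.cos x) hk, integral_cos, mul_neg,
      Real.sin_neg, Real.sin_int_mul_pi]
    simp

/-- The normalized kernel has mass 2π on a period. Off [-1/8, 1/8] it is at most 2m q^m with q < 1,
so eventually mass at least π remains in the centre, and π/2 ≥ 1. -/
theorem eventually_one_le_integral_cosPow_kernel :
    ∀ᶠ m : ℕ in Filter.atTop, 1 ≤ 2 ^ m / (m.centralBinom : ℝ) / 2 *
      ∫ ψ in (-(1 / 8 : ℝ))..(1 / 8), (1 + Real.cos ψ) ^ m := by
  have hpi := Real.two_le_pi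
  set q := (1 + Real.cos (1 / 8)) / 2 with hq
  have hc1 : Real.cos (1 / 8) < 1 := by
    have := Real.cos_lt_cos_of_nonneg_of_le_pi (x := 0) (y := 1 / 8) le_rfl (by linarith) (by norm_num)
    rwa [Real.cos_zero] at this
  have hq0 : 0 ≤ q := by linarith [one_add_cos_nonneg (1 / 8)]
  have hlim := (tendsto_two_mul_self_mul_pow hq0 (by linarith)).const_mul (2 * Real.pi)
  rw [mul_zero] at hlim
  filter_upwards [Filter.eventually_gt_atTop 0, hlim.eventually_le_const Real.pi_pos] with m hm hle
  set w := 2 ^ m / (m.centralBinom : ℝ) with hw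
  have hw0 : 0 ≤ w := by positivity
  have hint : ∀ a b : ℝ, IntervalIntegrable (fun ψ => (1 + Real.cos ψ) ^ m) volume a b :=
    fun a b => Continuous.intervalIntegrable (by fun_prop) _ _
  have htot := integral_cosPow_kernel m
  rw [← intervalIntegral.integral_add_adjacent_intervals (hint (-Real.pi) (-(1 / 8))) (hint _ _),
    ← intervalIntegral.integral_add_adjacent_intervals (hint (-(1 / 8)) (1 / 8)) (hint _ _)] at htot
  have bound : ∀ ψ : ℝ, 1 / 8 ≤ |ψ| → |ψ| ≤ Real.pi →
      (1 + Real.cos ψ) ^ m ≤ (2 * q) ^ m := by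
    intro ψ h1 h2
    refine pow_le_pow_left₀ (one_add_cos_nonneg ψ) ?_ m
    have := Real.cos_le_cos_of_nonneg_of_le_pi (by norm_num) h2 h1
    rw [Real.cos_abs] at this
    rw [hq]; linarith
  have hl : ∫ ψ in (-Real.pi)..(-(1 / 8)), (1 + Real.cos ψ) ^ m ≤ Real.pi * (2 * q) ^ m := by
    calc _ ≤ ∫ ψ in (-Real.pi)..(-(1 / 8)), (2 * q) ^ m := by
          refine intervalIntegral.integral_mono_on (by linarith) (hint _ _) (by simp) fun ψ hψ => ?_
          rw [Set.mem_Icc] at hψ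
          have : |ψ| = -ψ := abs_of_nonpos (by linarith)
          exact bound ψ (by linarith) (by linarith)
      _ = (Real.pi - 1 / 8) * (2 * q) ^ m := by
          rw [intervalIntegral.integral_const, smul_eq_mul]; ring
      _ ≤ _ := by gcongr; linarith
  have hr : ∫ ψ in (1 / 8 : ℝ)..Real.pi, (1 + Real.cos ψ) ^ m ≤ Real.pi * (2 * q) ^ m := by
    calc _ ≤ ∫ ψ in (1 / 8 : ℝ)..Real.pi, (2 * q) ^ m := by
          refine intervalIntegral.integral_mono_on (by linarith) (hint _ _) (by simp) fun ψ hψ => ?_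
          rw [Set.mem_Icc] at hψ
          have : |ψ| = ψ := abs_of_nonneg (by linarith)
          exact bound ψ (by linarith) (by linarith)
      _ = (Real.pi - 1 / 8) * (2 * q) ^ m := by
          rw [intervalIntegral.integral_const, smul_eq_mul]
      _ ≤ _ := by gcongr; linarith
  have hout : w * (2 * Real.pi * (2 * q) ^ m) ≤ Real.pi := by
    refine le_trans ?_ hle
    calc w * (2 * Real.pi * (2 * q) ^ m)
        ≤ 2 * m * (1 / 2) ^ m * (2 * Real.pi * (2 * q) ^ m) := by
          gcongr
          exact two_pow_div_centralBinom_le hm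
      _ = 2 * Real.pi * (2 * m * ((1 / 2) ^ m * (2 * q) ^ m)) := by ring
      _ = _ := by rw [← mul_pow]; ring_nf
  have h1 := mul_le_mul_of_nonneg_left (add_le_add hl hr) hw0
  rw [div_mul_eq_mul_div]
  linarith

/-- By positivity one may keep only the angles φ within 1/8 of θ, where the bump equals 1, and drop
the reflected half of the kernel. -/
theorem one_le_eval_testPoly_of_kernel {m : ℕ} (hm : 1 ≤ 2 ^ m / (m.centralBinom : ℝ) / 2 *
      ∫ ψ in (-(1 / 8 : ℝ))..(1 / 8), (1 + Real.cos ψ) ^ m) {θ : ℝ} (hθ : |θ| ≤ 1 / 4) :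
    1 ≤ (testPoly m).eval (Real.cos θ) := by
  refine hm.trans ?_
  rw [eval_testPoly, abs_le] at *
  have hnn : ∀ φ : ℝ, 0 ≤ 2 ^ m / (m.centralBinom : ℝ) *
      (((1 + Real.cos (θ - φ)) ^ m + (1 + Real.cos (θ + φ)) ^ m) / 2) := fun φ => by
    have h1 := one_add_cos_nonneg (θ - φ)
    have h2 := one_add_cos_nonneg (θ + φ)
    positivity
  have hcont : Continuous fun φ : ℝ => 2 ^ m / (m.centralBinom : ℝ) *
      (((1 + Real.cos (θ - φ)) ^ m + (1 + Real.cos (θ + φ)) ^ m) / 2) := by fun_prop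
  refine le_trans ?_ (setIntegral_le_integral (s := Set.Ioc (θ - 1 / 8) (θ + 1 / 8))
    (integrable_angleBump_mul hcont)
    (Filter.Eventually.of_forall fun φ => mul_nonneg angleBump.nonneg (hnn φ)))
  have hshift : ∫ ψ in (-(1 / 8 : ℝ))..(1 / 8), (1 + Real.cos ψ) ^ m
      = ∫ φ in (θ - 1 / 8)..(θ + 1 / 8), (1 + Real.cos (θ - φ)) ^ m := by
    rw [intervalIntegral.integral_comp_sub_left (fun ψ => (1 + Real.cos ψ) ^ m) θ]
    congr 1 <;> ring
  rw [hshift, intervalIntegral.integral_of_le (by linarith), ← integral_const_mul]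
  refine setIntegral_mono_on ?_ ?_ measurableSet_Ioc fun φ hφ => ?_
  · refine (Continuous.integrableOn_Icc (a := θ - 1 / 8) (b := θ + 1 / 8) ?_).mono_set
      Set.Ioc_subset_Icc_self
    fun_prop
  · exact (integrable_angleBump_mul hcont).integrableOn
  · have h1 : angleBump φ = 1 := by
      refine angleBump.one_of_mem_closedBall ?_
      rw [mem_closedBall_zero_iff, Real.norm_eq_abs, abs_le]
      change -(3 / 8 : ℝ) ≤ φ ∧ φ ≤ (3 / 8 : ℝ)
      constructor <;> linarith [hφ.1, hφ.2]
    have h2 := one_add_cos_nonneg (θ + φ)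
    have h3 : (0 : ℝ) ≤ 2 ^ m / (m.centralBinom : ℝ) / 2 := by positivity
    rw [h1, one_mul]
    have := mul_nonneg h3 (pow_nonneg h2 m)
    linarith

theorem eventually_one_le_eval_testPoly :
    ∀ᶠ m : ℕ in Filter.atTop, ∀ s ∈ Set.Icc (99 / 100 : ℝ) 1, 1 ≤ (testPoly m).eval s := by
  filter_upwards [eventually_one_le_integral_cosPow_kernel] with m hm s hs
  have hpi := Real.two_le_pi
  rw [← Real.cos_arccos (by linarith [hs.1]) hs.2]
  refine one_le_eval_testPoly_of_kernel hm ?_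
  -- The threshold 99/100 is admissible because cos(1/4) ≤ 99/100.
  rw [abs_of_nonneg (Real.arccos_nonneg s), ← Real.arccos_cos (x := 1 / 4) (by norm_num) (by linarith)]
  refine Real.arccos_le_arccos ?_
  refine le_trans ?_ hs.1
  have := (abs_le.1 (Real.cos_bound (x := 1 / 4) (by rw [abs_le]; constructor <;> norm_num))).2
  norm_num at this
  linarith

end TestPolynomialBounds

/-! ### Bernstein approximation of a step function -/

section ThresholdPolynomials

open Polynomial

theorem eval_bernstein_nonneg (m k : ℕ) {s : ℝ} (hs : s ∈ Set.Icc (0 : ℝ) 1) :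
    0 ≤ (bernsteinPolynomial ℝ m k).eval s := by
  have h1 : 0 ≤ 1 - s := by linarith [hs.2]
  have h0 := hs.1
  simp only [bernsteinPolynomial, eval_mul, eval_natCast, eval_pow, eval_X, eval_sub, eval_one]
  positivity

theorem sum_eval_bernstein (m : ℕ) (s : ℝ) :
    ∑ k ∈ Finset.range (m + 1), (bernsteinPolynomial ℝ m k).eval s = 1 := by
  rw [← eval_finsetSum, bernsteinPolynomial.sum, eval_one]

/-- Chebyshev's inequality for the binomial distribution, for a set of indices `k` at distance
at least `m δ` from `m s`. -/
theorem sum_eval_bernstein_le {m : ℕ} (hm : 0 < m) {s δ : ℝ}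
    (hs : s ∈ Set.Icc (0 : ℝ) 1) {I : Finset ℕ} (hI : I ⊆ Finset.range (m + 1))
    (hfar : ∀ k ∈ I, (m * δ) ^ 2 ≤ (m * s - k) ^ 2) :
    4 * m * δ ^ 2 * ∑ k ∈ I, (bernsteinPolynomial ℝ m k).eval s ≤ 1 := by
  have hvar := congrArg (eval s) (bernsteinPolynomial.variance ℝ m)
  rw [eval_finsetSum] at hvar
  simp only [nsmul_eq_mul, eval_mul, eval_pow, eval_sub, eval_natCast, eval_X, eval_one] at hvar
  have hm' : (0 : ℝ) < m := by exact_mod_cast hm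
  have h1 : (m * δ) ^ 2 * ∑ k ∈ I, (bernsteinPolynomial ℝ m k).eval s ≤ m * s * (1 - s) := by
    rw [← hvar, Finset.mul_sum]
    refine le_trans (Finset.sum_le_sum fun k hk =>
      mul_le_mul_of_nonneg_right (hfar k hk) (eval_bernstein_nonneg m k hs)) ?_
    exact Finset.sum_le_sum_of_subset_of_nonneg hI fun k _ _ =>
      mul_nonneg (sq_nonneg _) (eval_bernstein_nonneg m k hs)
  have h2 : m * s * (1 - s) ≤ m / 4 := by nlinarith [sq_nonneg (s - 1 / 2)]
  have h3 : m * (m * δ ^ 2 * ∑ k ∈ I, (bernsteinPolynomial ℝ m k).eval s) ≤ m * (1 / 4) := by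
    calc _ = (m * δ) ^ 2 * ∑ k ∈ I, (bernsteinPolynomial ℝ m k).eval s := by ring
      _ ≤ _ := by linarith
  have h4 := le_of_mul_le_mul_left h3 hm'
  linarith

/-- A polynomial of controlled degree with values in `[0, 1]` on `[-K, K]`, which is small on
`[-ρ, ρ]` and close to `1` on `ρ + ε ≤ |t| ≤ K`. -/
theorem exists_threshold_polynomial {K ρ ε : ℝ} (hρ : 0 ≤ ρ) (hε : 0 < ε) (hK : 0 < K)
    {m : ℕ} (hm : 100 * K ^ 4 ≤ m * ε ^ 4) :
    ∃ g : ℝ[X], g.natDegree ≤ 2 * m ∧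
      (∀ t, |t| ≤ K → g.eval t ∈ Set.Icc (0 : ℝ) 1) ∧
      (∀ t, |t| ≤ K → |t| ≤ ρ → g.eval t ≤ 1 / 100) ∧
      (∀ t, |t| ≤ K → ρ + ε ≤ |t| → 99 / 100 ≤ g.eval t) := by
  have hm' : (0 : ℝ) < m := by
    have : 0 < (m : ℝ) * ε ^ 4 := lt_of_lt_of_le (by positivity) hm
    exact pos_of_mul_pos_left this (by positivity)
  have hm0 : 0 < m := by exact_mod_cast hm'
  -- In the variable s = t²/K², the region |t| ≤ ρ is s ≤ a, and |t| ≥ ρ + ε implies s ≥ a + 2δ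
  -- since (ρ + ε)² ≥ ρ² + ε². The step sits midway, at a + δ; `hδm` makes both binomial tails at
  -- most 1/100.
  set a := ρ ^ 2 / K ^ 2 with ha
  set δ := ε ^ 2 / (2 * K ^ 2) with hδdef
  have hδ : 0 < δ := by positivity
  have hδm : 100 ≤ 4 * m * δ ^ 2 := by
    rw [hδdef, div_pow, mul_div_assoc', le_div_iff₀ (by positivity)]
    nlinarith
  set I := (Finset.range (m + 1)).filter (fun k : ℕ => m * (a + δ) ≤ k) with hI
  set G := ∑ k ∈ I, bernsteinPolynomial ℝ m k with hG
  have hIs : I ⊆ Finset.range (m + 1) := Finset.filter_subset _ _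
  have heval : ∀ t, (G.comp (C (1 / K ^ 2) * X ^ 2)).eval t
      = ∑ k ∈ I, (bernsteinPolynomial ℝ m k).eval (t ^ 2 / K ^ 2) := by
    intro t
    rw [eval_comp, hG, eval_finsetSum]
    simp only [eval_mul, eval_C, eval_pow, eval_X]
    rw [one_div_mul_eq_div]
  have hmem : ∀ t, |t| ≤ K → t ^ 2 / K ^ 2 ∈ Set.Icc (0 : ℝ) 1 := by
    intro t ht
    refine ⟨by positivity, div_le_one_of_le₀ ?_ (by positivity)⟩
    rw [← sq_abs]
    exact pow_le_pow_left₀ (abs_nonneg t) ht 2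
  have hsplit : ∀ s : ℝ, ∑ k ∈ I, (bernsteinPolynomial ℝ m k).eval s
      + ∑ k ∈ Finset.range (m + 1) \ I, (bernsteinPolynomial ℝ m k).eval s = 1 := by
    intro s
    rw [add_comm, Finset.sum_sdiff hIs, sum_eval_bernstein]
  refine ⟨G.comp (C (1 / K ^ 2) * X ^ 2), ?_, fun t ht => ?_, fun t ht htρ => ?_,
    fun t ht htρ => ?_⟩
  · refine natDegree_comp_le.trans ?_
    rw [mul_comm 2]
    refine Nat.mul_le_mul ?_ ((natDegree_C_mul_le _ _).trans (natDegree_X_pow_le 2))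
    refine natDegree_sum_le_of_forall_le _ _ fun k hk => ?_
    have hk' : k ≤ m := Nat.lt_succ_iff.1 (Finset.mem_range.1 (hIs hk))
    rw [bernsteinPolynomial, mul_assoc, ← C_eq_natCast]
    refine (natDegree_C_mul_le _ _).trans (natDegree_mul_le.trans ?_)
    have h1 : ((1 - X : ℝ[X]) ^ (m - k)).natDegree ≤ m - k := by
      refine natDegree_pow_le.trans ?_
      have : (1 - X : ℝ[X]).natDegree ≤ 1 := by compute_degree
      nlinarith
    have h2 := natDegree_X_pow_le (R := ℝ) k
    omega
  · rw [heval]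
    have h1 := Finset.sum_nonneg fun k (_ : k ∈ I) => eval_bernstein_nonneg m k (hmem t ht)
    have h2 := Finset.sum_nonneg fun k (_ : k ∈ Finset.range (m + 1) \ I) =>
      eval_bernstein_nonneg m k (hmem t ht)
    have h3 := hsplit (t ^ 2 / K ^ 2)
    exact ⟨h1, by linarith⟩
  · rw [heval]
    have hs : t ^ 2 / K ^ 2 ≤ a := by
      rw [ha, ← sq_abs]
      gcongr
    have h := sum_eval_bernstein_le hm0 (hmem t ht) hIs fun k hk => by
      have hk' := (Finset.mem_filter.1 hk).2
      have h1 : m * δ ≤ k - m * (t ^ 2 / K ^ 2) := by nlinarith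
      calc (m * δ) ^ 2 ≤ (k - m * (t ^ 2 / K ^ 2)) ^ 2 := pow_le_pow_left₀ (by positivity) h1 2
        _ = _ := by ring
    have h1 := Finset.sum_nonneg fun k (_ : k ∈ I) => eval_bernstein_nonneg m k (hmem t ht)
    nlinarith
  · rw [heval]
    have hs : a + 2 * δ ≤ t ^ 2 / K ^ 2 := by
      have : a + 2 * δ = (ρ ^ 2 + ε ^ 2) / K ^ 2 := by
        rw [ha, hδdef]; field_simp
      rw [this, ← sq_abs t]
      gcongr
      nlinarith
    have h := sum_eval_bernstein_le hm0 (hmem t ht) (Finset.sdiff_subset (t := I)) fun k hk => by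
      have hk' : (k : ℝ) < m * (a + δ) := by
        rw [Finset.mem_sdiff, hI, Finset.mem_filter, not_and, not_le] at hk
        exact hk.2 hk.1
      have h1 : m * δ ≤ m * (t ^ 2 / K ^ 2) - k := by nlinarith
      exact pow_le_pow_left₀ (by positivity) h1 2
    have h1 := Finset.sum_nonneg fun k (_ : k ∈ Finset.range (m + 1) \ I) =>
      eval_bernstein_nonneg m k (hmem t ht)
    have h3 := hsplit (t ^ 2 / K ^ 2)
    nlinarith

end ThresholdPolynomials

/-! ### Word length, degree and support size -/

section WordLength

open scoped Pointwise

variable {Λ : Type u} [Group Λ] {S : Finset Λ}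

theorem exists_word_of_closure_eq_top (hS : Subgroup.closure (S : Set Λ) = ⊤) (γ : Λ) :
    ∃ l : List Λ, (∀ s ∈ l, s ∈ S ∨ s⁻¹ ∈ S) ∧ l.prod = γ ∧ l.length = wordLength S γ := by
  have hne : {m : ℕ | ∃ l : List Λ, (∀ s ∈ l, s ∈ S ∨ s⁻¹ ∈ S) ∧ l.prod = γ ∧
      l.length = m}.Nonempty := by
    have hγ : γ ∈ Subgroup.closure (S : Set Λ) := hS ▸ Subgroup.mem_top γ
    rw [← Subgroup.mem_toSubmonoid, Subgroup.closure_toSubmonoid] at hγ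
    obtain ⟨l, hl, hprod⟩ := Submonoid.exists_list_of_mem_closure hγ
    exact ⟨l.length, l, hl, hprod, rfl⟩
  exact Nat.sInf_mem hne

theorem wordLength_le_of_word {l : List Λ} (hl : ∀ s ∈ l, s ∈ S ∨ s⁻¹ ∈ S) :
    wordLength S l.prod ≤ l.length :=
  Nat.sInf_le ⟨l, hl, rfl, rfl⟩

@[simp]
theorem wordLength_one : wordLength S (1 : Λ) = 0 := by
  have := wordLength_le_of_word (S := S) (l := []) (by simp)
  simpa using this

theorem wordLength_mul_le (hS : Subgroup.closure (S : Set Λ) = ⊤) (γ δ : Λ) :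
    wordLength S (γ * δ) ≤ wordLength S γ + wordLength S δ := by
  obtain ⟨l, hl, rfl, hlen⟩ := exists_word_of_closure_eq_top hS γ
  obtain ⟨l', hl', rfl, hlen'⟩ := exists_word_of_closure_eq_top hS δ
  rw [← hlen, ← hlen', ← List.length_append, ← List.prod_append]
  refine wordLength_le_of_word fun s hs => ?_
  rcases List.mem_append.1 hs with h | h
  exacts [hl s h, hl' s h]

theorem wordDegree_le_iff {x : MonoidAlgebra ℂ Λ} {d : ℕ} :
    wordDegree S x ≤ d ↔ ∀ γ ∈ x.coeff.support, wordLength S γ ≤ d :=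
  Finset.sup_le_iff

theorem wordDegree_one : wordDegree S (1 : MonoidAlgebra ℂ Λ) = 0 := by
  rw [← Nat.le_zero, wordDegree_le_iff]
  intro γ hγ
  have := MonoidAlgebra.support_coeff_one_subset hγ
  rw [Finset.mem_one] at this
  simp [this]

theorem wordDegree_mul_le (hS : Subgroup.closure (S : Set Λ) = ⊤) (x y : MonoidAlgebra ℂ Λ) :
    wordDegree S (x * y) ≤ wordDegree S x + wordDegree S y := by
  classical
  rw [wordDegree_le_iff]
  intro γ hγ
  obtain ⟨a, ha, b, hb, rfl⟩ := Finset.mem_mul.1 (MonoidAlgebra.support_coeff_mul_subset x y hγ)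
  exact (wordLength_mul_le hS a b).trans
    (add_le_add (wordDegree_le_iff.1 le_rfl a ha) (wordDegree_le_iff.1 le_rfl b hb))

theorem wordDegree_pow_le (hS : Subgroup.closure (S : Set Λ) = ⊤) (x : MonoidAlgebra ℂ Λ) (p : ℕ) :
    wordDegree S (x ^ p) ≤ p * wordDegree S x := by
  induction p with
  | zero => rw [pow_zero, wordDegree_one]; exact Nat.zero_le _
  | succ p ih =>
    rw [pow_succ, add_mul, one_mul]
    exact (wordDegree_mul_le hS _ _).trans (add_le_add_left ih _)

theorem wordDegree_aeval_le (hS : Subgroup.closure (S : Set Λ) = ⊤) (x : MonoidAlgebra ℂ Λ)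
    (P : Polynomial ℝ) :
    wordDegree S (Polynomial.aeval x P) ≤ P.natDegree * wordDegree S x := by
  classical
  rw [wordDegree_le_iff]
  intro γ hγ
  rw [Polynomial.aeval_eq_sum_range, MonoidAlgebra.coeff_sum] at hγ
  obtain ⟨i, hi, hγi⟩ := Finset.mem_biUnion.1 (Finsupp.support_finsetSum hγ)
  rw [MonoidAlgebra.coeff_smul] at hγi
  have h1 := wordDegree_le_iff.1 (wordDegree_pow_le hS x i) γ (Finsupp.support_smul hγi)
  exact h1.trans (Nat.mul_le_mul_right _ (Nat.lt_succ_iff.1 (Finset.mem_range.1 hi)))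

/-- Adding the identity to the symmetrized generators makes the powers of T increase, so T ^ Q
contains the whole ball of radius Q. -/
theorem card_support_le (hS : Subgroup.closure (S : Set Λ) = ⊤) {x : MonoidAlgebra ℂ Λ} {Q : ℕ}
    (hx : wordDegree S x ≤ Q) : x.coeff.support.card ≤ (2 * S.card + 1) ^ Q := by
  classical
  set T : Finset Λ := insert 1 (S ∪ S.image (·⁻¹)) with hT
  have hcard : T.card ≤ 2 * S.card + 1 := by
    refine (Finset.card_insert_le _ _).trans ?_
    have := Finset.card_union_le S (S.image (·⁻¹))
    have := Finset.card_image_le (s := S) (f := (·⁻¹))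
    omega
  have hprod : ∀ l : List Λ, (∀ s ∈ l, s ∈ S ∨ s⁻¹ ∈ S) → l.prod ∈ T ^ l.length := by
    intro l
    induction l with
    | nil => simp
    | cons a l ih =>
      intro hl
      rw [List.prod_cons, List.length_cons, pow_succ']
      refine Finset.mul_mem_mul ?_ (ih fun s hs => hl s (List.mem_cons_of_mem _ hs))
      rw [hT, Finset.mem_insert, Finset.mem_union, Finset.mem_image]
      rcases hl a List.mem_cons_self with h | h
      · exact Or.inr (Or.inl h)
      · exact Or.inr (Or.inr ⟨a⁻¹, h, inv_inv a⟩)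
  have hsub : x.coeff.support ⊆ T ^ Q := by
    intro γ hγ
    obtain ⟨l, hl, hlprod, hlen⟩ := exists_word_of_closure_eq_top hS γ
    rw [← hlprod]
    refine Finset.pow_subset_pow_right (Finset.mem_insert_self _ _) ?_ (hprod l hl)
    rw [hlen]
    exact wordDegree_le_iff.1 hx γ hγ
  exact (Finset.card_le_card hsub).trans
    (Finset.card_pow_le.trans (Nat.pow_le_pow_left hcard Q))

theorem one_le_card_of_wordDegree_pos (hS : Subgroup.closure (S : Set Λ) = ⊤)
    {x : MonoidAlgebra ℂ Λ} (hx : 0 < wordDegree S x) : 1 ≤ S.card := by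
  by_contra h
  have hS0 : S = ∅ := by
    rw [← Finset.card_eq_zero]; omega
  refine hx.ne' (Nat.le_zero.1 (wordDegree_le_iff.2 fun γ _ => ?_))
  have hγ : γ ∈ Subgroup.closure (S : Set Λ) := hS ▸ Subgroup.mem_top γ
  rw [hS0, Finset.coe_empty, Subgroup.closure_empty, Subgroup.mem_bot] at hγ
  simp [hγ]

theorem eq_single_of_wordDegree_eq_zero (hS : Subgroup.closure (S : Set Λ) = ⊤)
    {x : MonoidAlgebra ℂ Λ} (hx : wordDegree S x = 0) :
    x = algebraMap ℂ (MonoidAlgebra ℂ Λ) (x.coeff 1) := by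
  ext γ
  rw [MonoidAlgebra.coe_algebraMap]
  simp only [Function.comp_apply, MonoidAlgebra.coeff_single, Algebra.algebraMap_self, RingHom.id_apply]
  by_cases hγ : γ = 1
  · simp [hγ]
  · rw [Finsupp.single_eq_of_ne hγ]
    by_contra h
    have h0 := wordDegree_le_iff.1 hx.le γ (Finsupp.mem_support_iff.2 h)
    obtain ⟨l, -, hl, hlen⟩ := exists_word_of_closure_eq_top hS γ
    rw [Nat.le_zero.1 h0, List.length_eq_zero_iff] at hlen
    rw [hlen, List.prod_nil] at hl
    exact hγ hl.symm

end WordLength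

/-! ### Unitary representations and functional calculus -/

section Representations

variable {Λ : Type u} [Group Λ]

theorem repExt_apply {A : Type v} [Ring A] [StarRing A] [Algebra ℂ A] (π : Λ →* unitary A)
    (x : MonoidAlgebra ℂ Λ) : repExt π x = x.coeff.sum fun γ a => a • (π γ : A) := by
  rw [repExt, MonoidAlgebra.lift_apply]
  rfl

theorem repExt_aeval {A : Type v} [Ring A] [StarRing A] [Algebra ℂ A] [Algebra ℝ A]
    [IsScalarTower ℝ ℂ A] (π : Λ →* unitary A) (x : MonoidAlgebra ℂ Λ) (P : Polynomial ℝ) :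
    repExt π (Polynomial.aeval x P) = Polynomial.aeval (repExt π x) P :=
  (Polynomial.aeval_algHom_apply ((repExt π).restrictScalars ℝ) x P).symm

theorem isSelfAdjoint_repExt {A : Type v} [Ring A] [StarRing A] [Algebra ℂ A] [StarModule ℂ A]
    (π : Λ →* unitary A) {x : MonoidAlgebra ℂ Λ} (hx : IsSelfAdj x) :
    IsSelfAdjoint (repExt π x) := by
  rw [isSelfAdjoint_iff, repExt_apply, Finsupp.sum, star_sum]
  refine Finset.sum_nbij' (·⁻¹) (·⁻¹) ?_ ?_ ?_ ?_ ?_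
  · intro γ hγ
    rw [Finsupp.mem_support_iff] at hγ ⊢
    rw [hx γ]
    simpa using hγ
  · intro γ hγ
    rw [Finsupp.mem_support_iff] at hγ ⊢
    rw [hx γ]
    simpa using hγ
  · intro γ _; exact inv_inv γ
  · intro γ _; exact inv_inv γ
  · intro γ _
    rw [hx γ, star_smul, map_inv, ← Unitary.star_eq_inv, Unitary.coe_star]

/-- A unitary representation, transported by a homomorphism of star algebras. -/
def mapRep {A B : Type*} [Ring A] [StarRing A] [Algebra ℂ A] [Ring B] [StarRing B]
    [Algebra ℂ B] (Φ : A →⋆ₐ[ℂ] B) (π : Λ →* unitary A) : Λ →* unitary B where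
  toFun γ := ⟨Φ (π γ), Unitary.map_mem Φ (π γ).2⟩
  map_one' := by ext; simp
  map_mul' a b := by ext; simp

theorem repExt_mapRep {A B : Type*} [Ring A] [StarRing A] [Algebra ℂ A] [Ring B] [StarRing B]
    [Algebra ℂ B] (Φ : A →⋆ₐ[ℂ] B) (π : Λ →* unitary A) (x : MonoidAlgebra ℂ Λ) :
    repExt (mapRep Φ π) x = Φ (repExt π x) := by
  rw [repExt_apply, repExt_apply, Finsupp.sum, Finsupp.sum, map_sum]
  refine Finset.sum_congr rfl fun γ _ => ?_
  rw [map_smul]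
  rfl

theorem norm_repExt_le_fullNorm {H : Type u} [NormedAddCommGroup H] [InnerProductSpace ℂ H]
    [CompleteSpace H] (π : Λ →* unitary (H →L[ℂ] H)) (x : MonoidAlgebra ℂ Λ) :
    ‖repExt π x‖ ≤ fullNorm x :=
  le_csSup (bddAbove_repNorms x) ⟨H, _, _, _, π, rfl⟩

theorem fullNorm_le {x : MonoidAlgebra ℂ Λ} {b : ℝ}
    (h : ∀ (H : Type u) [NormedAddCommGroup H] [InnerProductSpace ℂ H] [CompleteSpace H]
      (π : Λ →* unitary (H →L[ℂ] H)), ‖repExt π x‖ ≤ b) : fullNorm x ≤ b := by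
  refine csSup_le (nonempty_repNorms x) ?_
  rintro _ ⟨H, _, _, _, π, rfl⟩
  exact h H π

theorem fullNorm_nonneg (x : MonoidAlgebra ℂ Λ) : 0 ≤ fullNorm x :=
  (norm_nonneg _).trans (norm_repExt_le_fullNorm (regRep Λ) x)

/-- `fullNorm` ranges over Hilbert spaces in the universe of Λ, so ℂⁿ must be lifted there before
matrix representations can be compared with it. -/
theorem exists_starAlgHom_norm_eq_matOpNorm (n : ℕ) :
    ∃ Φ : Matrix (Fin n) (Fin n) ℂ →⋆ₐ[ℂ]
      (EuclideanSpace ℂ (ULift.{u} (Fin n)) →L[ℂ] EuclideanSpace ℂ (ULift.{u} (Fin n))),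
      ∀ M, ‖Φ M‖ = matOpNorm M := by
  let e : EuclideanSpace ℂ (Fin n) ≃ₗᵢ[ℂ] EuclideanSpace ℂ (ULift.{u} (Fin n)) :=
    LinearIsometryEquiv.piLpCongrLeft 2 ℂ ℂ Equiv.ulift.symm
  let Θ : Matrix (Fin n) (Fin n) ℂ →⋆ₐ[ℂ]
    (EuclideanSpace ℂ (Fin n) →L[ℂ] EuclideanSpace ℂ (Fin n)) :=
    (Matrix.toEuclideanCLM (n := Fin n) (𝕜 := ℂ) : _ →⋆ₐ[ℂ] _)
  let Ψ : (EuclideanSpace ℂ (Fin n) →L[ℂ] EuclideanSpace ℂ (Fin n)) →⋆ₐ[ℂ]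
    (EuclideanSpace ℂ (ULift.{u} (Fin n)) →L[ℂ] EuclideanSpace ℂ (ULift.{u} (Fin n))) :=
    (e.conjStarAlgEquiv : _ →⋆ₐ[ℂ] _)
  refine ⟨Ψ.comp Θ, fun M => ?_⟩
  have hΨ : Function.Injective Ψ := e.conjStarAlgEquiv.injective
  exact NonUnitalStarAlgHom.norm_map Ψ hΨ (Θ M)

theorem matOpNorm_repExt_le_fullNorm {n : ℕ} (π : Λ →* Matrix.unitaryGroup (Fin n) ℂ)
    (x : MonoidAlgebra ℂ Λ) : matOpNorm (repExt π x) ≤ fullNorm x := by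
  obtain ⟨Φ, hΦ⟩ := exists_starAlgHom_norm_eq_matOpNorm.{u} n
  rw [← hΦ, ← repExt_mapRep]
  exact norm_repExt_le_fullNorm _ x

theorem abs_le_norm_of_mem_spectrum {A : Type*} [CStarAlgebra A] {a : A} {t : ℝ}
    (ht : t ∈ spectrum ℝ a) : |t| ≤ ‖a‖ := by
  rcases subsingleton_or_nontrivial A with h | h
  · rw [spectrum.of_subsingleton] at ht
    exact ht.elim
  · exact spectrum.norm_le_norm_of_mem ht

theorem norm_aeval_le {A : Type*} [CStarAlgebra A] {a : A} (ha : IsSelfAdjoint a)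
    {P : Polynomial ℝ} {b : ℝ} (hb : 0 ≤ b) (hP : ∀ t : ℝ, |t| ≤ ‖a‖ → |P.eval t| ≤ b) :
    ‖Polynomial.aeval a P‖ ≤ b := by
  rw [← cfc_polynomial P a ha]
  exact norm_cfc_le hb fun t ht => hP t (abs_le_norm_of_mem_spectrum ht)

theorem norm_repExt_aeval_le {H : Type*} [NormedAddCommGroup H] [InnerProductSpace ℂ H]
    [CompleteSpace H] (π : Λ →* unitary (H →L[ℂ] H)) {x : MonoidAlgebra ℂ Λ} (hx : IsSelfAdj x)
    {P : Polynomial ℝ} {b : ℝ} (hb : 0 ≤ b)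
    (hP : ∀ t : ℝ, |t| ≤ ‖repExt π x‖ → |P.eval t| ≤ b) :
    ‖repExt π (Polynomial.aeval x P)‖ ≤ b := by
  rw [repExt_aeval]
  exact norm_aeval_le (isSelfAdjoint_repExt π hx) hb hP

/-- This keeps T_k(y) in the unit ball for every k, however large the coefficients of T_k are. -/
theorem fullNorm_aeval_le {x : MonoidAlgebra ℂ Λ} (hx : IsSelfAdj x)
    {P : Polynomial ℝ} {b : ℝ} (hb : 0 ≤ b) (hP : ∀ t : ℝ, |t| ≤ fullNorm x → |P.eval t| ≤ b) :
    fullNorm (Polynomial.aeval x P) ≤ b :=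
  fullNorm_le fun _ _ _ _ π => norm_repExt_aeval_le π hx hb fun t ht =>
    hP t (ht.trans (norm_repExt_le_fullNorm π x))

end Representations

/-! ### Linear extension of the expansion coefficients -/

section LinearExtension

/-- `linExt` as a linear map. -/
def linExtLinear {Λ : Type u} (f : Λ → ℝ) : MonoidAlgebra ℂ Λ →ₗ[ℂ] ℂ :=
  (Finsupp.linearCombination ℂ fun γ => (f γ : ℂ)).comp
    (MonoidAlgebra.coeffLinearEquiv ℂ).toLinearMap

theorem linExtLinear_apply {Λ : Type u} (f : Λ → ℝ) (x : MonoidAlgebra ℂ Λ) :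
    linExtLinear f x = linExt f x := rfl

end LinearExtension

/-! ### The regular representation and moment bounds for u_0 and u_1 -/

section RegularRepresentation

open Classical in
theorem norm_ellTwo_single {Λ : Type u} (γ : Λ) :
    ‖(lp.single 2 γ (1 : ℂ) : ellTwo Λ)‖ = 1 := by
  rw [lp.norm_single (by norm_num), norm_one]

variable {Λ : Type u} [Group Λ]

theorem repExt_regRep_apply (z : MonoidAlgebra ℂ Λ) (f : ellTwo Λ) (δ : Λ) :
    (repExt (regRep Λ) z f) δ = z.coeff.sum fun γ a => a * f (γ⁻¹ * δ) := by
  rw [repExt_apply, Finsupp.sum, Finsupp.sum, sum_apply,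
    lp.coeFn_sum, Finset.sum_apply]
  refine Finset.sum_congr rfl fun γ _ => ?_
  rw [smul_apply, lp.coeFn_smul, Pi.smul_apply, regRep_apply, smul_eq_mul]

open Classical in
theorem repExt_regRep_single_apply (z : MonoidAlgebra ℂ Λ) (γ δ : Λ) :
    (repExt (regRep Λ) z (lp.single 2 γ (1 : ℂ))) δ = z.coeff (δ * γ⁻¹) := by
  rw [repExt_regRep_apply, Finsupp.sum_eq_single (δ * γ⁻¹)]
  · simp
  · intro h _ hne
    rw [lp.coeFn_single, Pi.single_eq_of_ne, mul_zero]
    intro h'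
    apply hne
    rw [← h']
    group
  · simp

/-- The coefficient at γ is the γ-entry of λ(z)δ_e. -/
theorem norm_coeff_le_norm_repExt_regRep (z : MonoidAlgebra ℂ Λ) (γ : Λ) :
    ‖z.coeff γ‖ ≤ ‖repExt (regRep Λ) z‖ := by
  classical
  have h1 := repExt_regRep_single_apply z 1 γ
  rw [inv_one, mul_one] at h1
  rw [← h1]
  refine (lp.norm_apply_le_norm (by norm_num) _ γ).trans ?_
  refine (ContinuousLinearMap.le_opNorm _ _).trans (le_of_eq ?_)
  rw [norm_ellTwo_single, mul_one]

theorem norm_coeff_le_fullNorm (z : MonoidAlgebra ℂ Λ) (γ : Λ) : ‖z.coeff γ‖ ≤ fullNorm z :=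
  (norm_coeff_le_norm_repExt_regRep z γ).trans (norm_repExt_le_fullNorm _ z)

theorem canTrace_repExt_regRep (z : MonoidAlgebra ℂ Λ) :
    canTrace (repExt (regRep Λ) z) = z.coeff 1 := by
  classical
  rw [canTrace, lp.inner_single_left, repExt_regRep_single_apply]
  simp

theorem linExt_eq_canTrace {f : Λ → ℝ}
    (hf : ∀ γ : Λ, (f γ : ℂ) = canTrace (regRep Λ γ : ellTwo Λ →L[ℂ] ellTwo Λ))
    (z : MonoidAlgebra ℂ Λ) : linExt f z = canTrace (repExt (regRep Λ) z) := by
  classical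
  rw [canTrace_repExt_regRep]
  have h : ∀ γ : Λ, (f γ : ℂ) = if γ = 1 then 1 else 0 := by
    intro γ
    rw [hf]
    have h1 : (regRep Λ γ : ellTwo Λ →L[ℂ] ellTwo Λ)
        = repExt (regRep Λ) (MonoidAlgebra.single γ 1) := by
      rw [repExt, MonoidAlgebra.lift_single, one_smul]; rfl
    rw [h1, canTrace_repExt_regRep, MonoidAlgebra.coeff_single, Finsupp.single_apply]
  simp [linExt, h, Finsupp.sum, eq_comm]

/-- The matrix entries of λ(y) are the coefficients of y, so self-adjointness in the group algebra
can be read off from operators, where functional calculus is available. -/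
theorem isSelfAdj_of_isSelfAdjoint_regRep {y : MonoidAlgebra ℂ Λ}
    (hy : IsSelfAdjoint (repExt (regRep Λ) y)) : IsSelfAdj y := by
  classical
  intro γ
  set T := repExt (regRep Λ) y with hT
  have h1 : inner ℂ (T (lp.single 2 (1 : Λ) (1 : ℂ))) (lp.single 2 γ (1 : ℂ) : ellTwo Λ)
      = inner ℂ (lp.single 2 (1 : Λ) (1 : ℂ) : ellTwo Λ) (T (lp.single 2 γ (1 : ℂ))) := by
    have := ContinuousLinearMap.adjoint_inner_left T (lp.single 2 γ (1 : ℂ) : ellTwo Λ)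
      (lp.single 2 (1 : Λ) (1 : ℂ))
    rwa [← ContinuousLinearMap.star_eq_adjoint, hy.star_eq] at this
  rw [lp.inner_single_left, lp.inner_single_right, hT, repExt_regRep_single_apply,
    repExt_regRep_single_apply] at h1
  simpa using h1.symm

theorem isSelfAdjoint_aeval {A : Type*} [CStarAlgebra A] {a : A} (ha : IsSelfAdjoint a)
    (P : Polynomial ℝ) : IsSelfAdjoint (Polynomial.aeval a P) := by
  rw [← cfc_polynomial P a ha]
  exact cfc_predicate _ _

theorem IsSelfAdj.aeval {x : MonoidAlgebra ℂ Λ} (hx : IsSelfAdj x) (P : Polynomial ℝ) :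
    IsSelfAdj (Polynomial.aeval x P) := by
  refine isSelfAdj_of_isSelfAdjoint_regRep ?_
  rw [repExt_aeval]
  exact isSelfAdjoint_aeval (isSelfAdjoint_repExt _ hx) P

theorem norm_repExt_pow_le {A : Type*} [CStarAlgebra A] (π : Λ →* unitary A)
    (y : MonoidAlgebra ℂ Λ) {p : ℕ} (hp : 0 < p) : ‖repExt π (y ^ p)‖ ≤ ‖repExt π y‖ ^ p := by
  rw [map_pow]
  exact norm_pow_le' _ hp

theorem exists_bound_of_eventually_le {f : ℕ → ℝ} {q : ℝ} (hq : 0 < q)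
    (h : ∀ᶠ p in Filter.atTop, |f p| ≤ q ^ p) : ∃ M : ℝ, ∀ p, |f p| ≤ M * q ^ p := by
  obtain ⟨N, hN⟩ := Filter.eventually_atTop.1 h
  refine ⟨1 + ∑ k ∈ Finset.range N, |f k| / q ^ k, fun p => ?_⟩
  have hnn : ∀ k ∈ Finset.range N, 0 ≤ |f k| / q ^ k := fun k _ => by positivity
  have hs := Finset.sum_nonneg hnn
  have hqp : 0 < q ^ p := by positivity
  rcases le_or_gt N p with hp | hp
  · exact (hN p hp).trans (le_mul_of_one_le_left hqp.le (by linarith))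
  · rw [← div_le_iff₀ hqp]
    have := Finset.single_le_sum hnn (Finset.mem_range.2 hp)
    linarith

/-- The strict inequality turns the limsup of p-th roots into an eventual geometric bound; M absorbs
the finitely many remaining p. -/
theorem Tempered.exists_bound {f : Λ → ℝ} (hf : Tempered f) {y : MonoidAlgebra ℂ Λ}
    (hy : IsSelfAdj y) {q : ℝ} (hq : ‖repExt (regRep Λ) y‖ < q) :
    ∃ M : ℝ, ∀ p : ℕ, |(linExt f (y ^ p)).re| ≤ M * q ^ p := by
  have hq0 : 0 < q := (norm_nonneg _).trans_lt hq
  refine exists_bound_of_eventually_le hq0 ?_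
  have h1 := (hf y hy).trans_lt (EReal.coe_lt_coe_iff.2 hq)
  filter_upwards [Filter.eventually_lt_of_limsup_lt h1, Filter.eventually_gt_atTop 0] with p hp hp0
  have h2 := (EReal.coe_lt_coe_iff.1 hp).le
  refine (Complex.abs_re_le_norm _).trans ?_
  have h3 := pow_le_pow_left₀ (by positivity) h2 p
  rwa [one_div, Real.rpow_inv_natCast_pow (norm_nonneg _) hp0.ne'] at h3

theorem exists_bound_canTrace {f : Λ → ℝ}
    (hf : ∀ γ : Λ, (f γ : ℂ) = canTrace (regRep Λ γ : ellTwo Λ →L[ℂ] ellTwo Λ))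
    {y : MonoidAlgebra ℂ Λ} {q : ℝ} (hq : ‖repExt (regRep Λ) y‖ < q) :
    ∃ M : ℝ, ∀ p : ℕ, |(linExt f (y ^ p)).re| ≤ M * q ^ p := by
  have hq0 : 0 < q := (norm_nonneg _).trans_lt hq
  refine exists_bound_of_eventually_le hq0 ?_
  filter_upwards [Filter.eventually_gt_atTop 0] with p hp0
  refine (Complex.abs_re_le_norm _).trans ?_
  rw [linExt_eq_canTrace hf, canTrace_repExt_regRep]
  refine (norm_coeff_le_norm_repExt_regRep _ _).trans ((norm_repExt_pow_le _ _ hp0).trans ?_)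
  exact pow_le_pow_left₀ (norm_nonneg _) hq.le p

end RegularRepresentation

/-! ### Eigenvalues, traces and norms of matrices -/

section Matrices

variable {n : ℕ}

theorem isSelfAdjoint_toEuclideanCLM {X : Matrix (Fin n) (Fin n) ℂ} (hX : X.IsHermitian) :
    IsSelfAdjoint (Matrix.toEuclideanCLM (n := Fin n) (𝕜 := ℂ) X) :=
  IsSelfAdjoint.map (show IsSelfAdjoint X from hX) _

theorem spectrum_toEuclideanCLM {X : Matrix (Fin n) (Fin n) ℂ} (hX : X.IsHermitian) :
    spectrum ℝ (Matrix.toEuclideanCLM (n := Fin n) (𝕜 := ℂ) X) = Set.range hX.eigenvalues := by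
  rw [← hX.spectrum_real_eq_range_eigenvalues]
  exact AlgEquiv.spectrum_eq
    ((Matrix.toEuclideanCLM (n := Fin n) (𝕜 := ℂ)).toAlgEquiv.restrictScalars ℝ) X

theorem abs_eigenvalues_le_matOpNorm {X : Matrix (Fin n) (Fin n) ℂ} (hX : X.IsHermitian)
    (i : Fin n) : |hX.eigenvalues i| ≤ matOpNorm X :=
  abs_le_norm_of_mem_spectrum (spectrum_toEuclideanCLM hX ▸ Set.mem_range_self i)

theorem exists_le_abs_eigenvalues {X : Matrix (Fin n) (Fin n) ℂ} (hX : X.IsHermitian) {b : ℝ}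
    (hb : 0 < b) (h : b ≤ matOpNorm X) : ∃ i, b ≤ |hX.eigenvalues i| := by
  by_contra! hlt
  refine h.not_gt ?_
  rw [matOpNorm, ← cfc_id ℝ (Matrix.toEuclideanCLM (n := Fin n) (𝕜 := ℂ) X)
    (isSelfAdjoint_toEuclideanCLM hX)]
  refine norm_cfc_lt hb fun t ht => ?_
  rw [spectrum_toEuclideanCLM hX] at ht
  obtain ⟨i, rfl⟩ := ht
  exact hlt i

theorem trace_aeval {X : Matrix (Fin n) (Fin n) ℂ} (hX : X.IsHermitian) (h : Polynomial ℝ) :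
    (Polynomial.aeval X h).trace = ∑ i, ((h.eval (hX.eigenvalues i) : ℝ) : ℂ) := by
  rw [← cfc_polynomial h X hX.isSelfAdjoint, hX.cfc_eq, Matrix.IsHermitian.cfc,
    Unitary.conjStarAlgAut_apply, Matrix.trace_mul_cycle, Unitary.coe_star_mul_self, one_mul,
    Matrix.trace_diagonal]
  rfl

theorem re_trace_aeval_nonneg {X : Matrix (Fin n) (Fin n) ℂ} (hX : X.IsHermitian)
    {h : Polynomial ℝ} (hh : ∀ t : ℝ, |t| ≤ matOpNorm X → 0 ≤ h.eval t) :
    0 ≤ (Polynomial.aeval X h).trace.re := by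
  rw [trace_aeval hX, Complex.re_sum]
  refine Finset.sum_nonneg fun i _ => ?_
  rw [Complex.ofReal_re]
  exact hh _ (abs_eigenvalues_le_matOpNorm hX i)

theorem one_le_re_trace_aeval {X : Matrix (Fin n) (Fin n) ℂ} (hX : X.IsHermitian)
    {h : Polynomial ℝ} (hh : ∀ t : ℝ, |t| ≤ matOpNorm X → 0 ≤ h.eval t) {b : ℝ} (hb : 0 < b)
    (hb' : b ≤ matOpNorm X) (hh1 : ∀ t : ℝ, |t| ≤ matOpNorm X → b ≤ |t| → 1 ≤ h.eval t) :
    1 ≤ (Polynomial.aeval X h).trace.re := by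
  rw [trace_aeval hX, Complex.re_sum]
  obtain ⟨i, hi⟩ := exists_le_abs_eigenvalues hX hb hb'
  refine (hh1 _ (abs_eigenvalues_le_matOpNorm hX i) hi).trans ?_
  have := Finset.single_le_sum (f := fun i => ((h.eval (hX.eigenvalues i) : ℝ) : ℂ).re)
    (fun j _ => by
      rw [Complex.ofReal_re]
      exact hh _ (abs_eigenvalues_le_matOpNorm hX j)) (Finset.mem_univ i)
  simpa using this

theorem norm_entry_le_one (U : Matrix.unitaryGroup (Fin n) ℂ) (i j : Fin n) :
    ‖(U : Matrix (Fin n) (Fin n) ℂ) i j‖ ≤ 1 :=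
  entry_norm_bound_of_unitary U.2 i j

theorem norm_ntr_unitary_le_one (hn : 1 ≤ n) (U : Matrix.unitaryGroup (Fin n) ℂ) :
    ‖ntr (U : Matrix (Fin n) (Fin n) ℂ)‖ ≤ 1 := by
  have hn' : (0 : ℝ) < n := by exact_mod_cast hn
  rw [ntr, norm_mul, norm_inv, Complex.norm_natCast, inv_mul_le_iff₀ hn', mul_one, Matrix.trace]
  refine (norm_sum_le _ _).trans ?_
  refine (Finset.sum_le_sum fun i _ => norm_entry_le_one U i i).trans ?_
  simp

theorem norm_ntr_le_matOpNorm (hn : 1 ≤ n) (M : Matrix (Fin n) (Fin n) ℂ) :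
    ‖ntr M‖ ≤ matOpNorm M := by
  have hn' : (0 : ℝ) < n := by exact_mod_cast hn
  rw [ntr, norm_mul, norm_inv, Complex.norm_natCast, inv_mul_le_iff₀ hn', Matrix.trace]
  refine (norm_sum_le _ _).trans ?_
  have hentry : ∀ i, ‖M.diag i‖ ≤ matOpNorm M := by
    intro i
    have h1 := ContinuousLinearMap.le_opNorm (Matrix.toEuclideanCLM (n := Fin n) (𝕜 := ℂ) M)
      (EuclideanSpace.single i (1 : ℂ))
    rw [PiLp.norm_single, norm_one, mul_one] at h1
    refine le_trans ?_ h1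
    refine le_trans (le_of_eq ?_) (PiLp.norm_apply_le _ i)
    congr 1
    rw [Matrix.ofLp_toEuclideanCLM]
    simp
  refine (Finset.sum_le_sum fun i _ => hentry i).trans ?_
  simp

end Matrices

/-! ### Expected normalized traces on the group algebra -/

section Expansion

open MeasureTheory

variable {Λ : Type u} [Group Λ]

theorem ntr_repExt {n : ℕ} (π : Λ →* Matrix.unitaryGroup (Fin n) ℂ) (z : MonoidAlgebra ℂ Λ) :
    ntr (repExt π z)
      = z.coeff.sum fun γ a => a * ntr (π γ : Matrix (Fin n) (Fin n) ℂ) := by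
  simp only [ntr]
  rw [repExt_apply, Finsupp.sum, Finsupp.sum, Matrix.trace_sum, Finset.mul_sum]
  refine Finset.sum_congr rfl fun γ _ => ?_
  rw [Matrix.trace_smul, smul_eq_mul]
  ring

variable {Ω : Type v} [MeasurableSpace Ω] {μ : Measure Ω} [IsProbabilityMeasure μ] {n : ℕ}
  {π : Ω → (Λ →* Matrix.unitaryGroup (Fin n) ℂ)}

theorem integrable_ntr (hn : 1 ≤ n)
    (hmeas : ∀ (γ : Λ) (i j : Fin n),
      Measurable fun ω => (π ω γ : Matrix (Fin n) (Fin n) ℂ) i j) (γ : Λ) :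
    Integrable (fun ω => ntr (π ω γ : Matrix (Fin n) (Fin n) ℂ)) μ := by
  refine Integrable.of_bound (C := 1) ?_
    (Filter.Eventually.of_forall fun ω => norm_ntr_unitary_le_one hn (π ω γ))
  refine Measurable.aestronglyMeasurable ?_
  simp only [ntr, Matrix.trace, Matrix.diag]
  exact (Finset.measurable_sum _ fun i _ => hmeas γ i i).const_mul _

theorem integrable_ntr_repExt (hn : 1 ≤ n)
    (hmeas : ∀ (γ : Λ) (i j : Fin n),
      Measurable fun ω => (π ω γ : Matrix (Fin n) (Fin n) ℂ) i j) (z : MonoidAlgebra ℂ Λ) :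
    Integrable (fun ω => ntr (repExt (π ω) z)) μ := by
  simp only [ntr_repExt, Finsupp.sum]
  exact integrable_finsetSum _ fun γ _ => (integrable_ntr hn hmeas γ).const_mul _

theorem integral_ntr_repExt (hn : 1 ≤ n)
    (hmeas : ∀ (γ : Λ) (i j : Fin n),
      Measurable fun ω => (π ω γ : Matrix (Fin n) (Fin n) ℂ) i j) (z : MonoidAlgebra ℂ Λ) :
    ∫ ω, ntr (repExt (π ω) z) ∂μ
      = z.coeff.sum fun γ a => a * ∫ ω, ntr (π ω γ : Matrix (Fin n) (Fin n) ℂ) ∂μ := by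
  simp only [ntr_repExt, Finsupp.sum]
  rw [integral_finsetSum _ fun γ _ => (integrable_ntr hn hmeas γ).const_mul _]
  exact Finset.sum_congr rfl fun γ _ => integral_const_mul _ _

theorem norm_integral_ntr_repExt_le (hn : 1 ≤ n) (z : MonoidAlgebra ℂ Λ) :
    ‖∫ ω, ntr (repExt (π ω) z) ∂μ‖ ≤ fullNorm z := by
  have := norm_integral_le_of_norm_le_const (μ := μ) (f := fun ω => ntr (repExt (π ω) z))
    (C := fullNorm z) (Filter.Eventually.of_forall fun ω =>
      (norm_ntr_le_matOpNorm hn _).trans (matOpNorm_repExt_le_fullNorm (π ω) z))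
  simpa using this

end Expansion

/-! ### The uniform second order expansion -/

section SecondOrder

open MeasureTheory

variable {Λ : Type u} [Group Λ] {S : Finset Λ} {Ω : ℕ → Type v} [∀ n, MeasurableSpace (Ω n)]
  {μ : ∀ n, Measure (Ω n)} [∀ n, IsProbabilityMeasure (μ n)]
  {π : ∀ n, Ω n → (Λ →* Matrix.unitaryGroup (Fin n) ℂ)} {C : ℝ} {u : ℕ → Λ → ℝ}

/-- The threshold beyond which the `1/n`-expansion of elements of degree at most `Q` is
effective. -/
def expansionThreshold (r c Q : ℕ) : ℕ := 24 * r * (c * Q) ^ c * Q ^ 2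

theorem rpow_le_natCast_pow {c Q : ℕ} (hC : 1 ≤ C) (hc : C ≤ c) (hQ : 1 ≤ Q) :
    (C * Q) ^ C ≤ (((c * Q) ^ c : ℕ) : ℝ) := by
  have hQ' : (1 : ℝ) ≤ Q := by exact_mod_cast hQ
  push_cast
  rw [← Real.rpow_natCast]
  calc (C * Q) ^ C ≤ (c * Q : ℝ) ^ C := by
        refine Real.rpow_le_rpow (by positivity) ?_ (by linarith)
        gcongr
    _ ≤ (c * Q : ℝ) ^ (c : ℝ) := Real.rpow_le_rpow_of_exponent_le (by nlinarith) hc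

/-- Coefficients are at most 1, the support has at most (3r)^Q elements, and each contributes an
error of at most (E/n)^Q with E = (cQ)^c. The exponential support size thus only rescales the base,
giving (3rE/n)^Q ≤ (N/n)^Q, and N ≤ n lowers the exponent to 2. -/
theorem norm_integral_sub_expansion_le (hC : 1 ≤ C) {c : ℕ} (hc : C ≤ c)
    (hS : Subgroup.closure (S : Set Λ) = ⊤)
    (hmeas : ∀ (n : ℕ) (γ : Λ) (i j : Fin n),
      Measurable fun ω => (π n ω γ : Matrix (Fin n) (Fin n) ℂ) i j)
    (hexp : EffectiveExpansion S μ π C u) (hr : 1 ≤ S.card)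
    {z : MonoidAlgebra ℂ Λ} (hz : fullNorm z ≤ 1) {Q : ℕ} (hQ : 2 ≤ Q) (hzQ : wordDegree S z ≤ Q)
    {n : ℕ} (hn : expansionThreshold S.card c Q ≤ n) :
    ‖(∫ ω, ntr (repExt (π n ω) z) ∂(μ n))
      - ∑ k ∈ Finset.range Q, linExt (u k) z / (n : ℂ) ^ k‖
      ≤ ((expansionThreshold S.card c Q : ℝ) / n) ^ 2 := by
  have hQ1 : 1 ≤ Q := by omega
  have hQ' : (1 : ℝ) ≤ Q := by exact_mod_cast hQ1
  have hc1 : 1 ≤ c := by exact_mod_cast hC.trans hc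
  have hpow := rpow_le_natCast_pow hC hc hQ1
  have hone : 1 ≤ (c * Q) ^ c := Nat.one_le_pow _ _ (by positivity)
  set E := (c * Q) ^ c with hE
  set N := expansionThreshold S.card c Q with hN
  -- The factor 24 = 3 · 8 in the threshold serves this bound and, in the Markov argument, 8Q² ≤ N.
  have hEN : 3 * S.card * E ≤ N := by
    rw [hN, expansionThreshold, ← hE]
    have : 1 ≤ Q ^ 2 := Nat.one_le_pow _ _ (by omega)
    calc 3 * S.card * E ≤ 24 * S.card * E * 1 := by nlinarith [Nat.zero_le (S.card * E)]
      _ ≤ _ := Nat.mul_le_mul_left _ this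
  have hN1 : 1 ≤ N := by nlinarith
  have hn1 : 1 ≤ n := hN1.trans hn
  have hn' : (0 : ℝ) < n := by exact_mod_cast hn1
  have hCn : C * (Q : ℝ) ^ C ≤ n := by
    have h1 : C ≤ C ^ C := by
      conv_lhs => rw [← Real.rpow_one C]
      exact Real.rpow_le_rpow_of_exponent_le hC hC
    calc C * (Q : ℝ) ^ C ≤ C ^ C * (Q : ℝ) ^ C := by gcongr
      _ = (C * Q) ^ C := (Real.mul_rpow (by linarith) (by linarith)).symm
      _ ≤ (E : ℝ) := hpow
      _ ≤ n := by
        have : E ≤ n := by nlinarith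
        exact_mod_cast this
  have hrw : (∫ ω, ntr (repExt (π n ω) z) ∂(μ n))
      - ∑ k ∈ Finset.range Q, linExt (u k) z / (n : ℂ) ^ k
      = ∑ γ ∈ z.coeff.support, z.coeff γ *
        ((∫ ω, ntr (π n ω γ : Matrix (Fin n) (Fin n) ℂ) ∂(μ n))
          - ∑ k ∈ Finset.range Q, (u k γ : ℂ) / (n : ℂ) ^ k) := by
    rw [integral_ntr_repExt hn1 (hmeas n), Finsupp.sum]
    simp only [mul_sub, Finset.sum_sub_distrib, linExt, Finsupp.sum, Finset.sum_div,
      Finset.mul_sum]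
    rw [Finset.sum_comm (s := z.coeff.support)]
    simp only [mul_div_assoc]
  rw [hrw]
  have hterm : ∀ γ ∈ z.coeff.support, ‖z.coeff γ *
        ((∫ ω, ntr (π n ω γ : Matrix (Fin n) (Fin n) ℂ) ∂(μ n))
          - ∑ k ∈ Finset.range Q, (u k γ : ℂ) / (n : ℂ) ^ k)‖ ≤ ((E : ℝ) / n) ^ Q := by
    intro γ hγ
    rw [norm_mul]
    have h1 := (norm_coeff_le_fullNorm z γ).trans hz
    have h2 := hexp.2 γ Q n (wordDegree_le_iff.1 hzQ γ hγ) hn1 hCn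
    refine (mul_le_of_le_one_left (norm_nonneg _) h1).trans (h2.trans ?_)
    rw [div_pow, Real.rpow_mul_natCast (by positivity)]
    gcongr
  refine (norm_sum_le _ _).trans ((Finset.sum_le_sum hterm).trans ?_)
  rw [Finset.sum_const, nsmul_eq_mul]
  have hcard : (z.coeff.support.card : ℝ) ≤ ((3 * S.card : ℕ) : ℝ) ^ Q := by
    have h1 := card_support_le hS hzQ
    have h2 : (2 * S.card + 1) ^ Q ≤ (3 * S.card) ^ Q := Nat.pow_le_pow_left (by omega) Q
    exact_mod_cast h1.trans h2
  have hNn : (N : ℝ) / n ≤ 1 := by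
    rw [div_le_one hn']; exact_mod_cast hn
  calc (z.coeff.support.card : ℝ) * ((E : ℝ) / n) ^ Q
      ≤ ((3 * S.card : ℕ) : ℝ) ^ Q * ((E : ℝ) / n) ^ Q := by gcongr
    _ = (((3 * S.card * E : ℕ) : ℝ) / n) ^ Q := by
        rw [← mul_pow, Nat.cast_mul _ E, mul_div_assoc]
    _ ≤ ((N : ℝ) / n) ^ Q := by gcongr
    _ ≤ ((N : ℝ) / n) ^ 2 := pow_le_pow_of_le_one (by positivity) hNn hQ

/-- The second order expansion of the expected normalized trace, uniformly over the unit ball of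
the full C*-algebra norm, with polynomial dependence on the degree. -/
theorem abs_second_order_le (hC : 1 ≤ C) {c : ℕ} (hc : C ≤ c)
    (hS : Subgroup.closure (S : Set Λ) = ⊤)
    (hmeas : ∀ (n : ℕ) (γ : Λ) (i j : Fin n),
      Measurable fun ω => (π n ω γ : Matrix (Fin n) (Fin n) ℂ) i j)
    (hexp : EffectiveExpansion S μ π C u) (hr : 1 ≤ S.card)
    {z : MonoidAlgebra ℂ Λ} (hz : fullNorm z ≤ 1) {Q : ℕ} (hQ : 2 ≤ Q) (hzQ : wordDegree S z ≤ Q)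
    {n : ℕ} (hn : 1 ≤ n) :
    |(∫ ω, ntr (repExt (π n ω) z) ∂(μ n)).re - (linExt (u 0) z).re - (linExt (u 1) z).re / n|
      ≤ 65 * (Q : ℝ) ^ 4 * (expansionThreshold S.card c Q : ℝ) ^ 2 / (n : ℝ) ^ 2 := by
  have hQ1 : (1 : ℝ) ≤ Q := by exact_mod_cast (by omega : 1 ≤ Q)
  have hc1 : 1 ≤ c := by exact_mod_cast hC.trans hc
  have hest := fun m (hm : expansionThreshold S.card c Q ≤ m) =>
    norm_integral_sub_expansion_le (n := m) hC hc hS hmeas hexp hr hz hQ hzQ hm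
  have hNQ : 8 * Q ^ 2 ≤ expansionThreshold S.card c Q := by
    have : 1 ≤ (c * Q) ^ c := Nat.one_le_pow _ _ (by positivity)
    have : 1 ≤ S.card * (c * Q) ^ c := by nlinarith
    rw [expansionThreshold]
    nlinarith [Nat.zero_le (Q ^ 2)]
  set N := expansionThreshold S.card c Q with hN
  have hN1 : 1 ≤ N := by nlinarith
  have hN' : (1 : ℝ) ≤ N := by exact_mod_cast hN1
  set P : Polynomial ℝ := ∑ k ∈ Finset.range Q,
    Polynomial.C (linExt (u k) z).re * Polynomial.X ^ k with hP
  have hcoeff : ∀ k < Q, P.coeff k = (linExt (u k) z).re := by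
    intro k hk
    rw [hP, Polynomial.finsetSum_coeff]
    simp only [Polynomial.coeff_C_mul_X_pow]
    rw [Finset.sum_ite_eq]
    simp [hk]
  have heval : ∀ m : ℕ, P.eval (1 / (m : ℝ))
      = (∑ k ∈ Finset.range Q, linExt (u k) z / (m : ℂ) ^ k).re := by
    intro m
    rw [hP, Polynomial.eval_finsetSum, Complex.re_sum]
    refine Finset.sum_congr rfl fun k _ => ?_
    rw [Polynomial.eval_mul, Polynomial.eval_C, Polynomial.eval_pow, Polynomial.eval_X, one_div,
      inv_pow, ← div_eq_mul_inv]
    have : ((m : ℂ) ^ k) = (((m : ℝ) ^ k : ℝ) : ℂ) := by push_cast; rfl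
    rw [this, Complex.div_ofReal_re]
  have hE1 : ∀ m : ℕ, 1 ≤ m → |(∫ ω, ntr (repExt (π m ω) z) ∂(μ m)).re| ≤ 1 := fun m hm =>
    (Complex.abs_re_le_norm _).trans ((norm_integral_ntr_repExt_le hm z).trans hz)
  have hdiff : ∀ m : ℕ, N ≤ m → |(∫ ω, ntr (repExt (π m ω) z) ∂(μ m)).re - P.eval (1 / (m : ℝ))|
      ≤ ((N : ℝ) / m) ^ 2 := by
    intro m hm
    rw [heval, ← Complex.sub_re]
    exact (Complex.abs_re_le_norm _).trans (hest m hm)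
  have hP2 : ∀ m : ℕ, N ≤ m → |P.eval (1 / (m : ℝ))| ≤ 2 := by
    intro m hm
    have hm' : (N : ℝ) ≤ m := by exact_mod_cast hm
    have h1 := hdiff m hm
    have h2 := hE1 m (hN1.trans hm)
    have h3 : ((N : ℝ) / m) ^ 2 ≤ 1 :=
      pow_le_one₀ (by positivity) ((div_le_one (by linarith)).2 hm')
    rw [abs_le] at *
    constructor <;> linarith
  have hdeg : P.natDegree ≤ Q := by
    refine Polynomial.natDegree_sum_le_of_forall_le _ _ fun k hk => ?_
    exact (Polynomial.natDegree_C_mul_X_pow_le _ _).trans (Finset.mem_range.1 hk).le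
  obtain ⟨t0, t1, t2⟩ := taylor_bounds_of_abs_eval_inv_nat_le hdeg (by omega) hNQ hP2
  rw [hcoeff 0 (by omega)] at t0 t2
  rw [hcoeff 1 (by omega)] at t1 t2
  have hn' : (1 : ℝ) ≤ n := by exact_mod_cast hn
  rw [le_div_iff₀ (by positivity)]
  have hQ4 : 1 ≤ (Q : ℝ) ^ 4 := one_le_pow₀ hQ1
  -- Below the threshold the expansion gives nothing for this n, but the trace is at most 1 and both
  -- coefficients are already bounded; as N/n > 1, these trivial bounds suffice.
  rcases le_or_gt N n with h | h
  · have hNn : (N : ℝ) ≤ n := by exact_mod_cast h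
    have h1 := hdiff n h
    have h2 := t2 (1 / n) ⟨by positivity, one_div_le_one_div_of_le (by linarith) hNn⟩
    rw [mul_one_div] at h2
    have h3 := abs_add_le ((∫ ω, ntr (repExt (π n ω) z) ∂(μ n)).re - P.eval (1 / (n : ℝ)))
      (P.eval (1 / (n : ℝ)) - (linExt (u 0) z).re - (linExt (u 1) z).re / n)
    rw [show ((∫ ω, ntr (repExt (π n ω) z) ∂(μ n)).re - P.eval (1 / (n : ℝ)))
      + (P.eval (1 / (n : ℝ)) - (linExt (u 0) z).re - (linExt (u 1) z).re / n)
      = (∫ ω, ntr (repExt (π n ω) z) ∂(μ n)).re - (linExt (u 0) z).re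
        - (linExt (u 1) z).re / n by ring] at h3
    calc _ ≤ (((N : ℝ) / n) ^ 2 + 64 * (Q : ℝ) ^ 4 * N ^ 2 * (1 / n) ^ 2) * (n : ℝ) ^ 2 := by
          refine mul_le_mul_of_nonneg_right ?_ (by positivity)
          linarith
      _ = N ^ 2 + 64 * (Q : ℝ) ^ 4 * N ^ 2 := by field_simp
      _ ≤ _ := by nlinarith [sq_nonneg (N : ℝ)]
  · have hnN : (n : ℝ) ≤ N := by exact_mod_cast h.le
    have h1 := hE1 n hn
    have hQ2 : (1 : ℝ) ≤ (Q : ℝ) ^ 2 := one_le_pow₀ hQ1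
    have hQ24 : (Q : ℝ) ^ 2 ≤ (Q : ℝ) ^ 4 := pow_le_pow_right₀ hQ1 (by norm_num)
    have h4 : |(linExt (u 1) z).re / n| ≤ 16 * (Q : ℝ) ^ 2 * N / n := by
      rw [abs_div, abs_of_pos (by linarith : (0 : ℝ) < n)]
      gcongr
    have h5 : |(∫ ω, ntr (repExt (π n ω) z) ∂(μ n)).re - (linExt (u 0) z).re
        - (linExt (u 1) z).re / n| ≤ 5 + 16 * (Q : ℝ) ^ 2 * N / n := by
      rw [abs_le] at *
      constructor <;> linarith
    calc _ ≤ (5 + 16 * (Q : ℝ) ^ 2 * N / n) * (n : ℝ) ^ 2 := by gcongr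
      _ = 5 * (n : ℝ) ^ 2 + 16 * (Q : ℝ) ^ 2 * (N * n) := by field_simp
      _ ≤ 5 * (N : ℝ) ^ 2 + 16 * (Q : ℝ) ^ 2 * (N * N) := by gcongr
      _ = (5 + 16 * (Q : ℝ) ^ 2) * N ^ 2 := by ring
      _ ≤ 65 * (Q : ℝ) ^ 4 * N ^ 2 := by
          gcongr
          linarith

end SecondOrder

/-! ### From the expansion to the tail probability -/

section TailBound

open MeasureTheory Polynomial

variable {Λ : Type u} [Group Λ] {S : Finset Λ}

/-- The real part of a complex functional of the group algebra, evaluated at polynomials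
in `y`. -/
def polyFunctional (φ : MonoidAlgebra ℂ Λ →ₗ[ℂ] ℂ) (y : MonoidAlgebra ℂ Λ) : ℝ[X] →ₗ[ℝ] ℝ :=
  Complex.reLm.comp ((φ.restrictScalars ℝ).comp (aeval (R := ℝ) y).toLinearMap)

theorem polyFunctional_apply (φ : MonoidAlgebra ℂ Λ →ₗ[ℂ] ℂ) (y : MonoidAlgebra ℂ Λ) (P : ℝ[X]) :
    polyFunctional φ y P = (φ (aeval y P)).re := rfl

/-- The expected normalized trace as a linear functional on the group algebra. -/
def expectedTrace {Ω : Type v} [MeasurableSpace Ω] (μ : Measure Ω) {n : ℕ}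
    (π : Ω → (Λ →* Matrix.unitaryGroup (Fin n) ℂ)) : MonoidAlgebra ℂ Λ →ₗ[ℂ] ℂ :=
  (Finsupp.linearCombination ℂ fun γ => ∫ ω, ntr (π ω γ : Matrix (Fin n) (Fin n) ℂ) ∂μ).comp
    (MonoidAlgebra.coeffLinearEquiv ℂ).toLinearMap

theorem expectedTrace_apply {Ω : Type v} [MeasurableSpace Ω] {μ : Measure Ω}
    [IsProbabilityMeasure μ] {n : ℕ} {π : Ω → (Λ →* Matrix.unitaryGroup (Fin n) ℂ)} (hn : 1 ≤ n)
    (hmeas : ∀ (γ : Λ) (i j : Fin n),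
      Measurable fun ω => (π ω γ : Matrix (Fin n) (Fin n) ℂ) i j) (z : MonoidAlgebra ℂ Λ) :
    expectedTrace μ π z = ∫ ω, ntr (repExt (π ω) z) ∂μ := by
  rw [integral_ntr_repExt hn hmeas]
  rfl

/-- On the event some eigenvalue has modulus at least b, so the unnormalized trace of h is at least
1. It is nonnegative everywhere, and Markov's inequality applies. -/
theorem measureReal_le_mul_expectedTrace {Ω : Type v} [MeasurableSpace Ω] {μ : Measure Ω}
    [IsProbabilityMeasure μ] {n : ℕ} {π : Ω → (Λ →* Matrix.unitaryGroup (Fin n) ℂ)} (hn : 1 ≤ n)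
    (hmeas : ∀ (γ : Λ) (i j : Fin n),
      Measurable fun ω => (π ω γ : Matrix (Fin n) (Fin n) ℂ) i j)
    {x : MonoidAlgebra ℂ Λ} (hx : IsSelfAdj x) {h : ℝ[X]} {b : ℝ} (hb : 0 < b)
    (h0 : ∀ t : ℝ, |t| ≤ fullNorm x → 0 ≤ h.eval t)
    (h1 : ∀ t : ℝ, |t| ≤ fullNorm x → b ≤ |t| → 1 ≤ h.eval t) :
    μ.real {ω | b ≤ matOpNorm (repExt (π ω) x)} ≤ n * (expectedTrace μ π (aeval x h)).re := by
  have hn' : (n : ℂ) ≠ 0 := by exact_mod_cast (by omega : n ≠ 0)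
  have hint := integrable_ntr_repExt (μ := μ) hn hmeas (aeval x h)
  have htr : ∀ ω, n * (ntr (repExt (π ω) (aeval x h))).re
      = (aeval (repExt (π ω) x) h).trace.re := by
    intro ω
    rw [← Complex.re_ofReal_mul, Complex.ofReal_natCast, ntr, mul_inv_cancel_left₀ hn', repExt_aeval]
  have hherm : ∀ ω, (repExt (π ω) x).IsHermitian := fun ω => isSelfAdjoint_repExt (π ω) hx
  have hle := fun ω => matOpNorm_repExt_le_fullNorm (π ω) x
  have hmarkov := mul_meas_ge_le_integral_of_nonneg (μ := μ)
    (f := fun ω => n * (ntr (repExt (π ω) (aeval x h))).re)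
    (Filter.Eventually.of_forall fun ω => by
      change 0 ≤ n * (ntr (repExt (π ω) (aeval x h))).re
      rw [htr]
      exact re_trace_aeval_nonneg (hherm ω) fun t ht => h0 t (ht.trans (hle ω)))
    (hint.re.const_mul _) 1
  rw [one_mul, integral_const_mul] at hmarkov
  rw [expectedTrace_apply hn hmeas, ← RCLike.re_eq_complex_re, ← integral_re hint]
  refine le_trans (measureReal_mono ?_) hmarkov
  intro ω hω
  rw [Set.mem_ofPred_eq] at hω ⊢
  rw [htr]
  exact one_le_re_trace_aeval (hherm ω) (fun t ht => h0 t (ht.trans (hle ω))) hb hω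
    fun t ht => h1 t (ht.trans (hle ω))

theorem abs_map_testPoly_le_of_forall_T (L : ℝ[X] →ₗ[ℝ] ℝ) {B : ℕ} {A b : ℝ} (hb : 0 ≤ b)
    (hL : ∀ k : ℤ, |L (Chebyshev.T ℝ k)| ≤ b * ((k.natAbs : ℝ) + 1) ^ B) {m : ℕ}
    (hA : ∑ j ∈ Finset.range (2 * m + 1), |binomWeight m j * bumpCoeff ((j : ℤ) - m)|
      * ((((j : ℤ) - m).natAbs : ℝ) + 1) ^ B ≤ A) :
    |L (testPoly m)| ≤ b * A := by
  rw [testPoly, map_sum]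
  refine (Finset.abs_sum_le_sum_abs _ _).trans ?_
  refine le_trans ?_ (mul_le_mul_of_nonneg_left hA hb)
  rw [Finset.mul_sum]
  refine Finset.sum_le_sum fun j _ => ?_
  rw [map_smul, smul_eq_mul, abs_mul, mul_left_comm]
  exact mul_le_mul_of_nonneg_left (hL _) (abs_nonneg _)

variable {Ω : ℕ → Type v} [∀ n, MeasurableSpace (Ω n)]
  {μ : ∀ n, Measure (Ω n)} [∀ n, IsProbabilityMeasure (μ n)]
  {π : ∀ n, Ω n → (Λ →* Matrix.unitaryGroup (Fin n) ℂ)} {C : ℝ} {u : ℕ → Λ → ℝ}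

/-- The multiplicative constant in the second order expansion. -/
def expansionConst (c : ℕ) : ℝ := 65 * 24 ^ 2 * (c : ℝ) ^ (2 * c)

theorem second_order_error_eq (r c Q : ℕ) :
    65 * (Q : ℝ) ^ 4 * (expansionThreshold r c Q : ℝ) ^ 2
      = expansionConst c * (r : ℝ) ^ 2 * (Q : ℝ) ^ (2 * c + 8) := by
  rw [expansionThreshold, expansionConst]
  push_cast
  ring

/-- The probability is at most n times the expected trace of `testPoly m` at y = g(x). The second
order error is bounded independently of m while the u_0 and u_1 terms tend to 0, so m → ∞ leaves
only the error. -/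
theorem measureReal_le_of_threshold (hC : 1 ≤ C) {c : ℕ} (hc : C ≤ c)
    (hS : Subgroup.closure (S : Set Λ) = ⊤)
    (hmeas : ∀ (n : ℕ) (γ : Λ) (i j : Fin n),
      Measurable fun ω => (π n ω γ : Matrix (Fin n) (Fin n) ℂ) i j)
    (hexp : EffectiveExpansion S μ π C u) (htemp : Tempered (u 1)) (hr : 1 ≤ S.card)
    {x : MonoidAlgebra ℂ Λ} (hx : IsSelfAdj x) {n : ℕ} (hn : 1 ≤ n) {b : ℝ} (hb : 0 < b)
    {g : ℝ[X]} (hg : ∀ t, |t| ≤ fullNorm x → g.eval t ∈ Set.Icc (0 : ℝ) 1)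
    (hg0 : ∀ t, |t| ≤ ‖repExt (regRep Λ) x‖ → g.eval t ≤ 1 / 100)
    (hg1 : ∀ t, |t| ≤ fullNorm x → b ≤ |t| → 99 / 100 ≤ g.eval t)
    {D : ℕ} (hD : 2 ≤ D) (hgD : g.natDegree * wordDegree S x ≤ D) {A : ℝ}
    (hA : ∀ m : ℕ, ∑ j ∈ Finset.range (2 * m + 1), |binomWeight m j * bumpCoeff ((j : ℤ) - m)|
      * ((((j : ℤ) - m).natAbs : ℝ) + 1) ^ (2 * c + 8) ≤ A) :
    (μ n).real {ω | b ≤ matOpNorm (repExt (π n ω) x)}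
      ≤ (S.card : ℝ) ^ 2 / n * (expansionConst c * A * (D : ℝ) ^ (2 * c + 8)) := by
  have hn' : (0 : ℝ) < n := by exact_mod_cast hn
  have hcst : 0 ≤ expansionConst c := by rw [expansionConst]; positivity
  set y := aeval (R := ℝ) x g with hy
  have hyadj : IsSelfAdj y := hx.aeval g
  have hregx := norm_repExt_le_fullNorm (regRep Λ) x
  have hyreg : ‖repExt (regRep Λ) y‖ ≤ 1 / 100 :=
    norm_repExt_aeval_le _ hx (by norm_num) fun t ht => by
      rw [abs_of_nonneg (hg t (ht.trans hregx)).1]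
      exact hg0 t ht
  have hyfull : fullNorm y ≤ 1 := fullNorm_aeval_le hx zero_le_one fun t ht => by
    rw [abs_of_nonneg (hg t ht).1]
    exact (hg t ht).2
  have hydeg : wordDegree S y ≤ D := (wordDegree_aeval_le hS x g).trans hgD
  set L0 := polyFunctional (linExtLinear (u 0)) y with hL0
  set L1 := polyFunctional (linExtLinear (u 1)) y with hL1
  set LE := polyFunctional (expectedTrace (μ n) (π n)) y with hLE
  -- The slack between 1/100 and 1/4 provides the strict inequality that the moment bounds require.
  have hlt : ‖repExt (regRep Λ) y‖ < 1 / 4 := by linarith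
  have ht0 : Filter.Tendsto (fun m => L0 (testPoly m)) Filter.atTop (nhds 0) := by
    obtain ⟨M, hM⟩ := exists_bound_canTrace hexp.1 hlt
    refine tendsto_map_testPoly L0 (M := M) fun p => ?_
    rw [hL0, polyFunctional_apply, aeval_X_pow, linExtLinear_apply]
    exact hM p
  have ht1 : Filter.Tendsto (fun m => L1 (testPoly m)) Filter.atTop (nhds 0) := by
    obtain ⟨M, hM⟩ := htemp.exists_bound hyadj hlt
    refine tendsto_map_testPoly L1 (M := M) fun p => ?_
    rw [hL1, polyFunctional_apply, aeval_X_pow, linExtLinear_apply]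
    exact hM p
  set β := expansionConst c * (S.card : ℝ) ^ 2 * (D : ℝ) ^ (2 * c + 8) / (n : ℝ) ^ 2 with hβ
  have hT : ∀ k : ℤ, |(LE - L0 - (n : ℝ)⁻¹ • L1) (Chebyshev.T ℝ k)|
      ≤ β * ((k.natAbs : ℝ) + 1) ^ (2 * c + 8) := by
    intro k
    have hfull : fullNorm (aeval y (Chebyshev.T ℝ k)) ≤ 1 :=
      fullNorm_aeval_le hyadj zero_le_one fun t ht =>
        Chebyshev.abs_eval_T_real_le_one k (ht.trans hyfull)
    -- Using |k| + 1 instead of |k| keeps the degree bound at least 2 when k = 0.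
    have hdeg : wordDegree S (aeval y (Chebyshev.T ℝ k)) ≤ (k.natAbs + 1) * D := by
      refine (wordDegree_aeval_le hS y _).trans ?_
      rw [Chebyshev.natDegree_T]
      exact Nat.mul_le_mul (Nat.le_succ _) hydeg
    have h2 : 2 ≤ (k.natAbs + 1) * D := by nlinarith [Nat.zero_le k.natAbs]
    have h := abs_second_order_le hC hc hS hmeas hexp hr hfull h2 hdeg hn
    rw [second_order_error_eq] at h
    rw [LinearMap.sub_apply, LinearMap.sub_apply, LinearMap.smul_apply, hLE, hL0, hL1,
      polyFunctional_apply, polyFunctional_apply, polyFunctional_apply, linExtLinear_apply,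
      linExtLinear_apply, expectedTrace_apply hn (hmeas n), smul_eq_mul, inv_mul_eq_div]
    refine h.trans (le_of_eq ?_)
    rw [hβ]
    push_cast
    rw [mul_pow]
    ring
  have hβ0 : 0 ≤ β := by rw [hβ]; positivity
  have hbound : ∀ᶠ m in Filter.atTop, (μ n).real {ω | b ≤ matOpNorm (repExt (π n ω) x)}
      ≤ n * (L0 (testPoly m) + (n : ℝ)⁻¹ * L1 (testPoly m) + β * A) := by
    filter_upwards [eventually_one_le_eval_testPoly] with m hm
    have h1 := measureReal_le_mul_expectedTrace (μ := μ n) (π := π n) hn (hmeas n) hx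
      (h := (testPoly m).comp g) hb
      (fun t ht => by
        rw [eval_comp]
        have := hg t ht
        exact eval_testPoly_nonneg m ⟨by linarith [this.1], this.2⟩)
      (fun t ht htb => by
        rw [eval_comp]
        exact hm _ ⟨hg1 t ht htb, (hg t ht).2⟩)
    have h2 := (abs_le.1 (abs_map_testPoly_le_of_forall_T _ hβ0 hT (hA m))).2
    rw [LinearMap.sub_apply, LinearMap.sub_apply, LinearMap.smul_apply, smul_eq_mul] at h2
    have h3 : (expectedTrace (μ n) (π n) (aeval x ((testPoly m).comp g))).re = LE (testPoly m) := by
      rw [hLE, polyFunctional_apply, hy, aeval_comp]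
    rw [h3] at h1
    refine h1.trans (mul_le_mul_of_nonneg_left ?_ hn'.le)
    linarith
  have hlim : Filter.Tendsto
      (fun m => n * (L0 (testPoly m) + (n : ℝ)⁻¹ * L1 (testPoly m) + β * A)) Filter.atTop
      (nhds (n * (0 + (n : ℝ)⁻¹ * 0 + β * A))) :=
    ((ht0.add (ht1.const_mul _)).add_const _).const_mul _
  refine (ge_of_tendsto hlim hbound).trans (le_of_eq ?_)
  rw [hβ]
  field_simp
  ring

/-- An element of degree 0 is a scalar. The final bound is 0 in this case, so the event must be
empty. -/
theorem matOpNorm_le_norm_repExt_regRep_of_wordDegree_eq_zero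
    (hS : Subgroup.closure (S : Set Λ) = ⊤) {x : MonoidAlgebra ℂ Λ} (hx : wordDegree S x = 0)
    {n : ℕ} (ρ : Λ →* Matrix.unitaryGroup (Fin n) ℂ) :
    matOpNorm (repExt ρ x) ≤ ‖repExt (regRep Λ) x‖ := by
  refine (matOpNorm_repExt_le_fullNorm ρ x).trans
    (le_trans ?_ (norm_coeff_le_norm_repExt_regRep x 1))
  refine fullNorm_le fun H _ _ _ σ => ?_
  conv_lhs => rw [eq_single_of_wordDegree_eq_zero hS hx]
  rw [AlgHom.commutes, Algebra.algebraMap_eq_smul_one, norm_smul]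
  exact mul_le_of_le_one_right (norm_nonneg _) ContinuousLinearMap.norm_id_le

theorem measureReal_le_pow (hC : 1 ≤ C) {c : ℕ} (hc : C ≤ c)
    (hS : Subgroup.closure (S : Set Λ) = ⊤)
    (hmeas : ∀ (n : ℕ) (γ : Λ) (i j : Fin n),
      Measurable fun ω => (π n ω γ : Matrix (Fin n) (Fin n) ℂ) i j)
    (hexp : EffectiveExpansion S μ π C u) (htemp : Tempered (u 1))
    {x : MonoidAlgebra ℂ Λ} (hx : IsSelfAdj x) {n : ℕ} (hn : 1 ≤ n) {ε : ℝ} (hε : 0 < ε)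
    (hxK : ‖repExt (regRep Λ) x‖ + ε ≤ fullNorm x) (hdeg : 1 ≤ wordDegree S x) {A : ℝ}
    (hA0 : 0 < A)
    (hA : ∀ m : ℕ, ∑ j ∈ Finset.range (2 * m + 1), |binomWeight m j * bumpCoeff ((j : ℤ) - m)|
      * ((((j : ℤ) - m).natAbs : ℝ) + 1) ^ (2 * c + 8) ≤ A) :
    (μ n).real {ω | ‖repExt (regRep Λ) x‖ + ε ≤ matOpNorm (repExt (π n ω) x)}
      ≤ (S.card : ℝ) ^ 2 / n * (expansionConst c * A * 202 ^ (2 * c + 8)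
        * (wordDegree S x * fullNorm x / ε) ^ (4 * (2 * c + 8))) := by
  have hcst : 0 ≤ expansionConst c := by rw [expansionConst]; positivity
  have hρ := norm_nonneg (repExt (regRep Λ) x)
  set ρ := ‖repExt (regRep Λ) x‖ with hρdef
  set K := fullNorm x with hK
  set d := wordDegree S x with hd
  have hd' : (1 : ℝ) ≤ d := by exact_mod_cast hdeg
  have hK0 : 0 < K := by linarith
  have hKε : 1 ≤ K / ε := by rw [le_div_iff₀ hε]; linarith
  -- The smallest m that the threshold polynomial allows; K/ε ≥ 1 absorbs the rounding, so the
  -- degree 2md is at most 202(dK/ε)^4.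
  set m := ⌈100 * (K / ε) ^ 4⌉₊ with hm
  have hm1 : 100 * (K / ε) ^ 4 ≤ m := Nat.le_ceil _
  have hKε4 : 1 ≤ (K / ε) ^ 4 := one_le_pow₀ hKε
  have hm2 : (m : ℝ) ≤ 101 * (K / ε) ^ 4 := by
    have := Nat.ceil_lt_add_one (a := 100 * (K / ε) ^ 4) (by positivity)
    linarith
  have hmpos : 1 ≤ m := by
    have : (1 : ℝ) ≤ m := by linarith
    exact_mod_cast this
  obtain ⟨g, hgdeg, hg, hg0, hg1⟩ := exists_threshold_polynomial hρ hε hK0 (m := m) (by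
    rw [div_pow, mul_div_assoc', div_le_iff₀ (by positivity)] at hm1
    exact hm1)
  have h := measureReal_le_of_threshold (D := 2 * m * d) hC hc hS hmeas hexp htemp
    (one_le_card_of_wordDegree_pos hS hdeg) hx hn (by linarith : 0 < ρ + ε) hg
    (fun t ht => hg0 t (ht.trans (by linarith)) ht) hg1 (by nlinarith)
    (Nat.mul_le_mul_right _ hgdeg) hA
  refine h.trans (mul_le_mul_of_nonneg_left ?_ (by positivity))
  have hD : ((2 * m * d : ℕ) : ℝ) ≤ 202 * (d * K / ε) ^ 4 := by
    push_cast
    calc 2 * (m : ℝ) * d ≤ 2 * (101 * (K / ε) ^ 4) * d := by gcongr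
      _ ≤ 2 * (101 * (K / ε) ^ 4) * d ^ 4 := by
          gcongr
          exact le_self_pow₀ hd' (by norm_num)
      _ = 202 * (d * K / ε) ^ 4 := by rw [mul_div_assoc, mul_pow]; ring
  calc expansionConst c * A * ((2 * m * d : ℕ) : ℝ) ^ (2 * c + 8)
      ≤ expansionConst c * A * (202 * (d * K / ε) ^ 4) ^ (2 * c + 8) := by gcongr
    _ = _ := by rw [mul_pow, ← pow_mul]; ring

/-- The prefactor is absorbed through a ≤ c ≤ c^c, and s ≥ 1 allows the exponent to grow to c. -/
theorem mul_pow_le_rpow {a c s : ℝ} {p : ℕ} (hs : 1 ≤ s) (hc1 : 1 ≤ c) (ha : a ≤ c)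
    (hp : (p : ℝ) ≤ c) : a * s ^ p ≤ (c * s) ^ c := by
  rw [Real.mul_rpow (by linarith) (by linarith)]
  have h1 : a ≤ c ^ c := by
    refine ha.trans ?_
    conv_lhs => rw [← Real.rpow_one c]
    exact Real.rpow_le_rpow_of_exponent_le hc1 hc1
  have h2 : s ^ p ≤ s ^ c := by
    rw [← Real.rpow_natCast]
    exact Real.rpow_le_rpow_of_exponent_le hs hp
  exact mul_le_mul h1 h2 (by positivity) (by positivity)

end TailBound

end GroupStrongConv

end

/-! ### Choice of the final constant -/

theorem theorem3p3 (C : ℝ) (hC : 1 ≤ C) :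
    ∃ c : ℝ, 0 < c ∧
      ∀ (Λ : Type*) [Group Λ] (S : Finset Λ), Subgroup.closure (S : Set Λ) = ⊤ →
      ∀ (Ω : ℕ → Type*) [∀ n, MeasurableSpace (Ω n)]
        (μ : ∀ n, MeasureTheory.Measure (Ω n)) [∀ n, MeasureTheory.IsProbabilityMeasure (μ n)]
        (π : ∀ n, Ω n → (Λ →* Matrix.unitaryGroup (Fin n) ℂ)),
        (∀ (n : ℕ) (γ : Λ) (i j : Fin n),
          Measurable fun ω => (π n ω γ : Matrix (Fin n) (Fin n) ℂ) i j) →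
      ∀ u : ℕ → Λ → ℝ,
        GroupStrongConv.EffectiveExpansion S μ π C u →
        GroupStrongConv.Tempered (u 1) →
      ∀ x : MonoidAlgebra ℂ Λ, GroupStrongConv.IsSelfAdj x →
      ∀ (n : ℕ) (ε : ℝ), 1 ≤ n → 0 < ε →
        (μ n).real {ω | ‖GroupStrongConv.repExt (GroupStrongConv.regRep Λ) x‖ + ε
            ≤ GroupStrongConv.matOpNorm (GroupStrongConv.repExt (π n ω) x)}
          ≤ (S.card : ℝ) ^ 2 / n *
            (c * GroupStrongConv.wordDegree S x * GroupStrongConv.fullNorm x / ε) ^ c := by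
  obtain ⟨A, hA0, hA⟩ := GroupStrongConv.exists_sum_testPoly_coeff_le (2 * ⌈C⌉₊ + 8)
  set a := GroupStrongConv.expansionConst ⌈C⌉₊ * A * 202 ^ (2 * ⌈C⌉₊ + 8)
  set p := 4 * (2 * ⌈C⌉₊ + 8)
  refine ⟨max 1 (max a p), by positivity, ?_⟩
  intro Λ _ S hS Ω _ μ _ π hmeas u hexp htemp x hx n ε hn hε
  have hK0 := GroupStrongConv.fullNorm_nonneg x
  -- In the degenerate cases, degree 0 or ‖λ(x)‖ + ε > K, the event is empty. Otherwise |x|K/ε ≥ 1,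
  -- as needed to raise the exponent.
  by_cases hempty : GroupStrongConv.wordDegree S x = 0 ∨ GroupStrongConv.fullNorm x
      < ‖GroupStrongConv.repExt (GroupStrongConv.regRep Λ) x‖ + ε
  · have hset : {ω | ‖GroupStrongConv.repExt (GroupStrongConv.regRep Λ) x‖ + ε
        ≤ GroupStrongConv.matOpNorm (GroupStrongConv.repExt (π n ω) x)} = ∅ := by
      rw [Set.eq_empty_iff_forall_notMem]
      intro ω hω
      rw [Set.mem_ofPred_eq] at hω
      rcases hempty with h | h
      · have := GroupStrongConv.matOpNorm_le_norm_repExt_regRep_of_wordDegree_eq_zero hS h (π n ω)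
        linarith
      · have := GroupStrongConv.matOpNorm_repExt_le_fullNorm (π n ω) x
        linarith
    rw [hset, MeasureTheory.measureReal_empty]
    positivity
  · rw [not_or, not_lt] at hempty
    obtain ⟨hd, hK⟩ := hempty
    have hd1 : 1 ≤ GroupStrongConv.wordDegree S x := Nat.one_le_iff_ne_zero.2 hd
    have hd' : (1 : ℝ) ≤ GroupStrongConv.wordDegree S x := by exact_mod_cast hd1
    refine (GroupStrongConv.measureReal_le_pow hC (Nat.le_ceil C) hS hmeas hexp htemp hx hn hε hK
      hd1 hA0 hA).trans (mul_le_mul_of_nonneg_left ?_ (by positivity))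
    rw [mul_assoc (max 1 (max a p)), mul_div_assoc (max 1 (max a p))]
    refine GroupStrongConv.mul_pow_le_rpow ?_ (le_max_left _ _)
      ((le_max_left _ _).trans (le_max_right _ _)) ((le_max_right _ _).trans (le_max_right _ _))
    rw [le_div_iff₀ hε]
    have hρ := norm_nonneg (GroupStrongConv.repExt (GroupStrongConv.regRep Λ) x)
    nlinarith
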